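/- Let $n\ge 1$ be an integer and $s\in(0,1)$. There exists $\Theta=\Theta(n,s)>1$, depending only on $n$ and $s$, such that the following holds for every bounded open set $\Omega\subset\mathbb R^n$ with Lipschitz boundary. Write $\mathcal C\Omega:=\mathbb R^n\setminus\Omega$, $Q(\Omega):=\mathbb R^{2n}\setminus(\mathcal C\Omega)^2$ and $\Omega_t:=\{y\in\mathbb R^n : \operatorname{dist}(y,\Omega)<t\}$. Let $\mathcal W^s(\Omega)$ be the set of measurable functions $u\colon\mathbb R^n\to\mathbb R$ such that $u\in L^1(\Omega)$ and $$\int_\Omega\int_\Omega\frac{|u(x)-u(y)|}{|x-y|^{n+s}}\,dx\,dy<+\infty .$$ A function $u\in\mathcal W^s(\Omega)$ is called $s$-minimal in $\Omega$ if, for every $v\in\mathcal W^s(\Omega)$ with $u=v$ almost everywhere in $\mathcal C\Omega$, the following integral converges absolutely and satisfies $$\iint_{Q(\Omega)}\big(|u(x)-u(y)|-|v(x)-v(y)|\big)\frac{dx\,dy}{|x-y|^{n+s}}\le 0 .$$ If $\varphi\colon\mathcal C\Omega\to\mathbb R$ is measurable and $$\int_\Omega\bigg[\int_{\Omega_{\Theta\operatorname{diam}(\Omega)}\setminus\Omega}\frac{|\varphi(y)|}{|x-y|^{n+s}}\,dy\bigg]\,dx<+\infty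 ,$$ then there exists an $s$-minimal function $u$ in $\Omega$ that belongs to $\mathcal W^s_\varphi(\Omega):=\{u\in\mathcal W^s(\Omega) : u=\varphi \text{ in } \mathcal C\Omega\}$. -/

import Mathlib

open MeasureTheory Set
open scoped ENNReal NNReal

noncomputable section

/-- The boundary of `Ω ⊆ ℝⁿ` is Lipschitz: near each boundary point, for a suitable unit vector `e`
(the vertical direction), `Ω` is the strict epigraph of a Lipschitz function `g` of the component
`x - ⟪e, x⟫ e` of `x` orthogonal to `e`. (Only the values of `g` on the hyperplane orthogonal to `e`
matter; a Lipschitz function on that hyperplane always extends to the whole space.) -/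
def HasLipschitzBoundary {n : ℕ} (Ω : Set (EuclideanSpace ℝ (Fin n))) : Prop :=
  ∀ p ∈ frontier Ω, ∃ (e : EuclideanSpace ℝ (Fin n)) (r : ℝ) (K : ℝ≥0)
    (g : EuclideanSpace ℝ (Fin n) → ℝ),
    ‖e‖ = 1 ∧ 0 < r ∧ LipschitzWith K g ∧
      ∀ x ∈ Metric.ball p r, (x ∈ Ω ↔ g (x - inner ℝ e x • e) < inner ℝ e x)

/-- The Gagliardo seminorm `∫_Ω ∫_Ω |u(x) - u(y)| / |x - y|^(n+s) dy dx`, with values in `[0, ∞]`. -/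
def gagliardoSeminorm {n : ℕ} (s : ℝ) (Ω : Set (EuclideanSpace ℝ (Fin n)))
    (u : EuclideanSpace ℝ (Fin n) → ℝ) : ℝ≥0∞ :=
  ∫⁻ x in Ω, ∫⁻ y in Ω, ENNReal.ofReal (|u x - u y| / ‖x - y‖ ^ ((n : ℝ) + s))

/-- The space `𝒲^s(Ω)` of the (Lebesgue) measurable functions `u : ℝⁿ → ℝ` whose restriction to `Ω`
lies in `W^{s,1}(Ω)`, that is, is integrable with finite Gagliardo seminorm. For the Lebesgue measure
`volume`, being Lebesgue measurable is the same as `AEMeasurable`. -/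
def sobolevSpaceW {n : ℕ} (s : ℝ) (Ω : Set (EuclideanSpace ℝ (Fin n))) :
    Set (EuclideanSpace ℝ (Fin n) → ℝ) :=
  {u | AEMeasurable u volume ∧ IntegrableOn u Ω volume ∧ gagliardoSeminorm s Ω u < ∞}

/-- The space `𝒲^s_φ(Ω)` of the `u ∈ 𝒲^s(Ω)` with `u = φ` outside `Ω`. The values of `φ` in `Ω` play
no role. -/
def sobolevSpaceWWithDatum {n : ℕ} (s : ℝ) (Ω : Set (EuclideanSpace ℝ (Fin n)))
    (φ : EuclideanSpace ℝ (Fin n) → ℝ) : Set (EuclideanSpace ℝ (Fin n) → ℝ) :=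
  {u | u ∈ sobolevSpaceW s Ω ∧ ∀ y ∈ Ωᶜ, u y = φ y}

/-- The set `Q(Ω) = ℝ²ⁿ \ (ℝⁿ \ Ω)²`. -/
def interactionSet {n : ℕ} (Ω : Set (EuclideanSpace ℝ (Fin n))) :
    Set (EuclideanSpace ℝ (Fin n) × EuclideanSpace ℝ (Fin n)) :=
  (Ωᶜ ×ˢ Ωᶜ)ᶜ

/-- The renormalised energy density `(|u(x) - u(y)| - |v(x) - v(y)|) / |x - y|^(n+s)`. -/
def energyDifference {n : ℕ} (s : ℝ) (u v : EuclideanSpace ℝ (Fin n) → ℝ)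
    (z : EuclideanSpace ℝ (Fin n) × EuclideanSpace ℝ (Fin n)) : ℝ :=
  (|u z.1 - u z.2| - |v z.1 - v z.2|) / ‖z.1 - z.2‖ ^ ((n : ℝ) + s)

/-- `u ∈ 𝒲^s(Ω)` is an `s`-minimal function in `Ω`: for every competitor `v ∈ 𝒲^s(Ω)` with `u = v`
almost everywhere outside `Ω`, the integral over `Q(Ω)` of the energy difference (which converges
absolutely) is nonpositive. -/
def IsSMinimalFunction {n : ℕ} (s : ℝ) (Ω : Set (EuclideanSpace ℝ (Fin n)))
    (u : EuclideanSpace ℝ (Fin n) → ℝ) : Prop :=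
  u ∈ sobolevSpaceW s Ω ∧
    ∀ v ∈ sobolevSpaceW s Ω, (∀ᵐ x ∂volume, x ∈ Ωᶜ → u x = v x) →
      IntegrableOn (energyDifference s u v) (interactionSet Ω) volume ∧
        ∫ z in interactionSet Ω, energyDifference s u v z ≤ 0

/-- The `L¹(Ω)` norm, in `[0, ∞]`, of the local tail of `φ` in `O \ Ω`:
`∫_Ω [∫_{O \ Ω} |φ(y)| / |x - y|^(n+s) dy] dx`. -/
def localTailIntegral {n : ℕ} (s : ℝ) (Ω O : Set (EuclideanSpace ℝ (Fin n)))
    (φ : EuclideanSpace ℝ (Fin n) → ℝ) : ℝ≥0∞ :=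
  ∫⁻ x in Ω, ∫⁻ y in O \ Ω, ENNReal.ofReal (|φ y| / ‖x - y‖ ^ ((n : ℝ) + s))

end

/-! The constant is Θ = 2·4^(1/s). The full energy of a function with exterior datum φ may be
infinite, because nothing controls φ far from Ω; only differences of energies make sense. They are
finite by a fractional Hardy inequality, `lintegral_abs_mul_kernelPotential_compl_lt_top`: for w in
𝒲^s(Ω), |w(x)| times the integral of |x - y|^(-n-s) over y outside Ω is integrable on Ω. Applied to
w = u - v, it controls the interactions across the boundary, since ||u(x) - φ(y)| - |v(x) - φ(y)|| ≤
|w(x)|. An s-minimal function is thus a minimiser of `renormalisedEnergy`, the energy minus that of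
φ extended by zero.

For the Hardy inequality, cut Ω near a boundary point into layers of geometrically growing height
over the graph. The next higher layer contains N disjoint translates of a layer, so N times the mass
of |w| on the lower one is at most the mass on the higher one plus a Gagliardo term. With weights
height^(-s), the higher layer's term carries a factor (2N + 2)^s, and N beats it for large N because
s < 1; the recursion then sums.

The renormalised energy is the Gagliardo seminorm plus twice the integral of `tailEnergy`.
Coercivity in L¹(Ω) (`mul_abs_le_tailEnergy`) comes from comparing kernel masses: exterior points
within distance Θ diam Ω contribute growth in |t| up to the local tail of φ, farther points lose at
most |t| times a kernel mass that Θ makes small.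

Compactness is replaced by convexity (`exists_forall_le_of_midpointConvex_of_coercive`): among
near-minimisers, those that also nearly minimise ∫ √(1 + u²) have an almost everywhere convergent
subsequence, and Fatou's lemma concludes. -/

noncomputable section

/-! ### The Riesz kernel: tails and potentials. -/

/-- The kernel `|z|^{-(n+s)}`. -/
def rieszKernel {n : ℕ} (s : ℝ) (z : EuclideanSpace ℝ (Fin n)) : ℝ := (‖z‖ ^ ((n : ℝ) + s))⁻¹

lemma rieszKernel_nonneg {n : ℕ} (s : ℝ) (z : EuclideanSpace ℝ (Fin n)) : 0 ≤ rieszKernel s z := by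
  unfold rieszKernel; positivity

@[fun_prop]
lemma measurable_rieszKernel {n : ℕ} (s : ℝ) :
    Measurable (rieszKernel s : EuclideanSpace ℝ (Fin n) → ℝ) := by
  unfold rieszKernel; fun_prop

lemma rieszKernel_smul {n : ℕ} (s : ℝ) {ρ : ℝ} (hρ : 0 < ρ) (z : EuclideanSpace ℝ (Fin n)) :
    rieszKernel s (ρ • z) = (ρ ^ ((n : ℝ) + s))⁻¹ * rieszKernel s z := by
  unfold rieszKernel
  rw [norm_smul, Real.norm_of_nonneg hρ.le, Real.mul_rpow hρ.le (norm_nonneg _), mul_inv]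

/-- The mass of `|z|^{-(n+s)}` outside the ball of radius `ρ`. -/
def kernelTail (n : ℕ) (s ρ : ℝ) : ℝ≥0∞ :=
  ∫⁻ z in {z : EuclideanSpace ℝ (Fin n) | ρ ≤ ‖z‖}, ENNReal.ofReal (rieszKernel s z)

lemma measurableSet_le_norm {n : ℕ} (ρ : ℝ) :
    MeasurableSet {z : EuclideanSpace ℝ (Fin n) | ρ ≤ ‖z‖} :=
  measurableSet_le measurable_const measurable_norm

/-- Substituting z ↦ ρz gives ρ^n from the volume and ρ^(-n-s) from homogeneity. The exact power is
what later fixes the constant Θ. -/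
lemma kernelTail_eq (n : ℕ) (s : ℝ) {ρ : ℝ} (hρ : 0 < ρ) :
    kernelTail n s ρ = ENNReal.ofReal (ρ ^ (-s)) * kernelTail n s 1 := by
  have hm : Measurable (fun z : EuclideanSpace ℝ (Fin n) => ENNReal.ofReal (rieszKernel s z)) := by
    fun_prop
  have key : ENNReal.ofReal (ρ ^ ((n : ℝ) + s))⁻¹ * kernelTail n s 1
      = ENNReal.ofReal (ρ ^ n)⁻¹ * kernelTail n s ρ := by
    unfold kernelTail
    rw [← lintegral_indicator (measurableSet_le_norm _), ← lintegral_indicator (measurableSet_le_norm _)]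
    have h := Measure.map_addHaar_smul (volume : Measure (EuclideanSpace ℝ (Fin n))) hρ.ne'
    have h2 : ENNReal.ofReal (ρ ^ n)⁻¹ * ∫⁻ z : EuclideanSpace ℝ (Fin n),
        indicator {z | ρ ≤ ‖z‖} (fun z => ENNReal.ofReal (rieszKernel s z)) z
        = ∫⁻ z, indicator {z | ρ ≤ ‖z‖} (fun z => ENNReal.ofReal (rieszKernel s z)) z
          ∂(Measure.map (ρ • ·) (volume : Measure (EuclideanSpace ℝ (Fin n)))) := by
      rw [h, lintegral_smul_measure, smul_eq_mul, finrank_euclideanSpace_fin,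
        abs_of_nonneg (by positivity)]
    rw [h2, lintegral_map (hm.indicator (measurableSet_le_norm _)) (measurable_const_smul ρ),
      ← lintegral_const_mul _ (hm.indicator (measurableSet_le_norm _))]
    refine lintegral_congr fun z => ?_
    by_cases hz : 1 ≤ ‖z‖
    · have hz' : ρ ≤ ‖ρ • z‖ := by
        rw [norm_smul, Real.norm_of_nonneg hρ.le]; nlinarith
      rw [indicator_of_mem (by exact hz), indicator_of_mem (by exact hz'),
        rieszKernel_smul s hρ, ENNReal.ofReal_mul (by positivity)]
    · have hz' : ¬ ρ ≤ ‖ρ • z‖ := by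
        rw [norm_smul, Real.norm_of_nonneg hρ.le]; intro h; apply hz
        by_contra h3; push Not at h3; nlinarith
      rw [indicator_of_notMem (by exact hz), indicator_of_notMem (by exact hz'), mul_zero]
  have e1 : ENNReal.ofReal (ρ ^ n) * ENNReal.ofReal (ρ ^ n)⁻¹ = 1 := by
    rw [← ENNReal.ofReal_mul (by positivity), mul_inv_cancel₀ (by positivity), ENNReal.ofReal_one]
  have e2 : ρ ^ (-s) = ρ ^ n * (ρ ^ ((n : ℝ) + s))⁻¹ := by
    rw [← Real.rpow_natCast, ← Real.rpow_neg hρ.le, ← Real.rpow_add hρ]; congr 1; ring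
  rw [e2, ENNReal.ofReal_mul (by positivity), mul_assoc, key, ← mul_assoc, e1, one_mul]

lemma kernelTail_one_lt_top (n : ℕ) {s : ℝ} (hs : 0 < s) : kernelTail n s 1 < ∞ := by
  have h := finite_integral_one_add_norm (E := EuclideanSpace ℝ (Fin n)) (μ := volume)
    (r := (n : ℝ) + s) (by rw [finrank_euclideanSpace_fin]; linarith)
  have hC : (0 : ℝ) ≤ (2 : ℝ) ^ ((n : ℝ) + s) := by positivity
  calc kernelTail n s 1
      ≤ ∫⁻ z in {z : EuclideanSpace ℝ (Fin n) | 1 ≤ ‖z‖}, ENNReal.ofReal ((2 : ℝ) ^ ((n : ℝ) + s))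
          * ENNReal.ofReal ((1 + ‖z‖) ^ (-((n : ℝ) + s))) := by
        refine setLIntegral_mono' (measurableSet_le_norm _) fun z hz => ?_
        rw [← ENNReal.ofReal_mul hC]
        refine ENNReal.ofReal_le_ofReal ?_
        have hz : 1 ≤ ‖z‖ := hz
        have h0 : 0 < ‖z‖ := by linarith
        unfold rieszKernel
        rw [Real.rpow_neg (by positivity), ← div_eq_mul_inv, ← Real.div_rpow (by norm_num) (by positivity),
          ← Real.inv_rpow (by positivity)]
        refine Real.rpow_le_rpow (by positivity) ?_ (by positivity)
        rw [inv_eq_one_div, div_le_div_iff₀ h0 (by positivity)]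
        linarith
    _ ≤ ∫⁻ z : EuclideanSpace ℝ (Fin n), ENNReal.ofReal ((2 : ℝ) ^ ((n : ℝ) + s))
          * ENNReal.ofReal ((1 + ‖z‖) ^ (-((n : ℝ) + s))) := setLIntegral_le_lintegral _ _
    _ = ENNReal.ofReal ((2 : ℝ) ^ ((n : ℝ) + s)) * ∫⁻ z : EuclideanSpace ℝ (Fin n),
          ENNReal.ofReal ((1 + ‖z‖) ^ (-((n : ℝ) + s))) := by
        rw [lintegral_const_mul _ (by fun_prop)]
    _ < ∞ := ENNReal.mul_lt_top ENNReal.ofReal_lt_top h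

lemma kernelTail_lt_top (n : ℕ) {s : ℝ} (hs : 0 < s) {ρ : ℝ} (hρ : 0 < ρ) :
    kernelTail n s ρ < ∞ := by
  rw [kernelTail_eq n s hρ]
  exact ENNReal.mul_lt_top ENNReal.ofReal_lt_top (kernelTail_one_lt_top n hs)

lemma kernelTail_one_pos {n : ℕ} (hn : 1 ≤ n) (s : ℝ) : 0 < kernelTail n s 1 := by
  have : Nonempty (Fin n) := ⟨⟨0, hn⟩⟩
  rw [kernelTail, setLIntegral_pos_iff (by fun_prop)]
  have hsub : {z : EuclideanSpace ℝ (Fin n) | 1 < ‖z‖} ⊆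
      Function.support (fun z : EuclideanSpace ℝ (Fin n) => ENNReal.ofReal (rieszKernel s z)) ∩
        {z | 1 ≤ ‖z‖} := by
    intro z hz
    have hz : 1 < ‖z‖ := hz
    refine ⟨?_, hz.le⟩
    rw [Function.mem_support]
    have : 0 < rieszKernel s z := by
      have h0 : 0 < ‖z‖ := by linarith
      unfold rieszKernel; positivity
    simpa using this
  refine lt_of_lt_of_le ?_ (measure_mono hsub)
  refine (isOpen_lt continuous_const continuous_norm).measure_pos volume ?_
  obtain ⟨z, hz⟩ := NormedSpace.exists_lt_norm ℝ (EuclideanSpace ℝ (Fin n)) 1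
  exact ⟨z, hz⟩

lemma lintegral_rieszKernel_sub_tail {n : ℕ} (s ρ : ℝ) (x : EuclideanSpace ℝ (Fin n)) :
    ∫⁻ y in {y | ρ ≤ ‖x - y‖}, ENNReal.ofReal (rieszKernel s (x - y)) = kernelTail n s ρ := by
  have hms : MeasurableSet {y : EuclideanSpace ℝ (Fin n) | ρ ≤ ‖x - y‖} :=
    measurableSet_le measurable_const (by fun_prop)
  rw [kernelTail, ← lintegral_indicator hms, ← lintegral_indicator (measurableSet_le_norm _),
    ← lintegral_sub_left_eq_self (indicator {z | ρ ≤ ‖z‖} fun z => ENNReal.ofReal (rieszKernel s z)) x]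
  rfl

/-- The potential `∫_{A} |x - y|^{-(n+s)} dy`. -/
def kernelPotential {n : ℕ} (s : ℝ) (A : Set (EuclideanSpace ℝ (Fin n)))
    (x : EuclideanSpace ℝ (Fin n)) : ℝ≥0∞ :=
  ∫⁻ y in A, ENNReal.ofReal (rieszKernel s (x - y))

lemma kernelPotential_le_kernelTail {n : ℕ} (s : ℝ) {A : Set (EuclideanSpace ℝ (Fin n))}
    {x : EuclideanSpace ℝ (Fin n)} {ρ : ℝ} (h : ∀ y ∈ A, ρ ≤ ‖x - y‖) :
    kernelPotential s A x ≤ kernelTail n s ρ := by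
  rw [← lintegral_rieszKernel_sub_tail s ρ x]
  exact lintegral_mono_set h

lemma kernelTail_le_kernelPotential {n : ℕ} (s : ℝ) {A : Set (EuclideanSpace ℝ (Fin n))}
    {x : EuclideanSpace ℝ (Fin n)} {ρ : ℝ} (h : ∀ y, ρ ≤ ‖x - y‖ → y ∈ A) :
    kernelTail n s ρ ≤ kernelPotential s A x := by
  rw [← lintegral_rieszKernel_sub_tail s ρ x]
  exact lintegral_mono_set h

/-! ### The fractional Hardy inequality on bounded Lipschitz domains. -/

lemma setLIntegral_comp_add_right {n : ℕ} {f : EuclideanSpace ℝ (Fin n) → ℝ≥0∞}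
    {D : Set (EuclideanSpace ℝ (Fin n))} (hD : MeasurableSet D) (h : EuclideanSpace ℝ (Fin n)) :
    ∫⁻ x in D, f (x + h) = ∫⁻ y in {y | y - h ∈ D}, f y := by
  have hT : MeasurableSet {y | y - h ∈ D} := (measurable_id.sub_const h) hD
  rw [← lintegral_indicator hD, ← lintegral_indicator hT,
    ← lintegral_add_right_eq_self ({y | y - h ∈ D}.indicator f) h]
  refine lintegral_congr fun x => ?_
  by_cases hx : x ∈ D
  · rw [indicator_of_mem hx, indicator_of_mem (by simpa using hx)]
  · rw [indicator_of_notMem hx, indicator_of_notMem (by simpa using hx)]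

/-- If the translates of `D` by the vectors `c i` are disjoint, and remain inside `D'` under small
perturbations, then the mass of `w` on `D` is controlled by `1 / N` times the mass on `D'`, up to
the Gagliardo interaction of `D` with `Ω`. -/
lemma card_mul_setLIntegral_le_of_translates {n : ℕ} {s : ℝ} (hs : 0 < s)
    {w : EuclideanSpace ℝ (Fin n) → ℝ}
    (hw : Measurable w) {Ω D D' B : Set (EuclideanSpace ℝ (Fin n))} (hΩ : MeasurableSet Ω)
    (hD : MeasurableSet D) (hB : MeasurableSet B) (hDΩ : D' ⊆ Ω) (N : ℕ)
    (c : ℕ → EuclideanSpace ℝ (Fin n)) {R : ℝ}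
    (hmem : ∀ i ∈ Finset.Icc 1 N, ∀ η ∈ B, ∀ x ∈ D, x + (c i + η) ∈ D')
    (hdisj : ∀ i ∈ Finset.Icc 1 N, ∀ j ∈ Finset.Icc 1 N, i ≠ j → ∀ x ∈ D, ∀ y ∈ D,
      x + c i ≠ y + c j)
    (hnorm : ∀ i ∈ Finset.Icc 1 N, ∀ η ∈ B, ‖c i + η‖ ≤ R) :
    volume B * (N * ∫⁻ x in D, ENNReal.ofReal |w x|) ≤
      volume B * (∫⁻ x in D', ENNReal.ofReal |w x|) +
        N * (ENNReal.ofReal (R ^ ((n : ℝ) + s)) *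
          ∫⁻ x in D, ∫⁻ y in Ω, ENNReal.ofReal (|w x - w y| / ‖x - y‖ ^ ((n : ℝ) + s))) := by
  set q : ℝ := (n : ℝ) + s with hq
  have hq0 : 0 < q := by positivity
  have hW : Measurable fun x => ENNReal.ofReal |w x| := by fun_prop
  set F : ℕ → EuclideanSpace ℝ (Fin n) → ℝ≥0∞ := fun i η =>
    ∫⁻ x in D, ENNReal.ofReal |w x - w (x + (c i + η))| with hF
  have hFm : ∀ i, Measurable (F i) := by
    intro i
    refine Measurable.lintegral_prod_right' (f := fun z : _ × _ =>
      ENNReal.ofReal |w z.2 - w (z.2 + (c i + z.1))|) ?_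
    fun_prop
  -- For a fixed perturbation η, write |w(x)| ≤ |w(x + c i + η)| + |w(x) - w(x + c i + η)| and sum
  -- over i: the translated sets are disjoint and lie in `D'`, so their masses add up to at most the
  -- mass of `D'`.
  have step1 : ∀ η ∈ B, N * ∫⁻ x in D, ENNReal.ofReal |w x| ≤
      (∫⁻ x in D', ENNReal.ofReal |w x|) + ∑ i ∈ Finset.Icc 1 N, F i η := by
    intro η hη
    have h1 : ∀ i ∈ Finset.Icc 1 N, ∫⁻ x in D, ENNReal.ofReal |w x| ≤
        (∫⁻ y in {y | y - (c i + η) ∈ D}, ENNReal.ofReal |w y|) + F i η := by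
      intro i _
      rw [← setLIntegral_comp_add_right (f := fun y => ENNReal.ofReal |w y|) hD, hF,
        ← lintegral_add_left (by fun_prop)]
      refine lintegral_mono fun x => ?_
      rw [← ENNReal.ofReal_add (abs_nonneg _) (abs_nonneg _)]
      refine ENNReal.ofReal_le_ofReal ?_
      have := abs_sub_abs_le_abs_sub (w x) (w (x + (c i + η)))
      linarith
    calc N * ∫⁻ x in D, ENNReal.ofReal |w x|
        = ∑ i ∈ Finset.Icc 1 N, ∫⁻ x in D, ENNReal.ofReal |w x| := by simp
      _ ≤ ∑ i ∈ Finset.Icc 1 N, ((∫⁻ y in {y | y - (c i + η) ∈ D}, ENNReal.ofReal |w y|) + F i η) :=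
        Finset.sum_le_sum h1
      _ = (∑ i ∈ Finset.Icc 1 N, ∫⁻ y in {y | y - (c i + η) ∈ D}, ENNReal.ofReal |w y|)
          + ∑ i ∈ Finset.Icc 1 N, F i η := Finset.sum_add_distrib
      _ ≤ _ := by
        gcongr
        rw [← lintegral_biUnion_finset]
        · refine lintegral_mono_set ?_
          intro y hy
          simp only [mem_iUnion] at hy
          obtain ⟨i, hi, hy⟩ := hy
          have := hmem i hi η hη _ hy
          simpa using this
        · intro i hi j hj hij
          refine Set.disjoint_left.2 fun y hy hy' => ?_
          refine hdisj i hi j hj hij _ hy _ hy' ?_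
          abel
        · intro i _
          exact (measurable_id.sub_const _) hD
  -- Integrating over η turns the difference along one shift into a double integral with y = x + c i
  -- + η. As |x - y| ≤ R there, inserting the kernel costs a factor R^q.
  have step2 : ∀ i ∈ Finset.Icc 1 N, ∫⁻ η in B, F i η ≤ ENNReal.ofReal (R ^ q) *
      ∫⁻ x in D, ∫⁻ y in Ω, ENNReal.ofReal (|w x - w y| / ‖x - y‖ ^ q) := by
    intro i hi
    rw [hF, lintegral_lintegral_swap (by fun_prop)]
    have hm2 : Measurable fun x => ∫⁻ y in Ω, ENNReal.ofReal (|w x - w y| / ‖x - y‖ ^ q) := by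
      refine Measurable.lintegral_prod_right' (f := fun z : _ × _ =>
        ENNReal.ofReal (|w z.1 - w z.2| / ‖z.1 - z.2‖ ^ q)) ?_
      fun_prop
    rw [← lintegral_const_mul _ hm2]
    refine setLIntegral_mono' hD fun x hx => ?_
    set f : EuclideanSpace ℝ (Fin n) → ℝ≥0∞ := Ω.indicator fun y =>
      ENNReal.ofReal (R ^ q) * ENNReal.ofReal (|w x - w y| / ‖x - y‖ ^ q) with hf
    have e : ENNReal.ofReal (R ^ q) * ∫⁻ y in Ω, ENNReal.ofReal (|w x - w y| / ‖x - y‖ ^ q)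
        = ∫⁻ η, f (x + c i + η) := by
      rw [lintegral_add_left_eq_self f, hf, lintegral_indicator hΩ, lintegral_const_mul _ (by fun_prop)]
    rw [e, ← lintegral_indicator hB]
    refine lintegral_mono fun η => ?_
    by_cases hη : η ∈ B
    · have hy : x + c i + η ∈ Ω := by
        rw [add_assoc]; exact hDΩ (hmem i hi η hη x hx)
      have hn : ‖x - (x + (c i + η))‖ ≤ R := by
        rw [sub_add_cancel_left, norm_neg]; exact hnorm i hi η hη
      rw [indicator_of_mem hη, hf, indicator_of_mem hy, add_assoc]
      have hR : 0 ≤ R := (norm_nonneg _).trans hn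
      rw [← ENNReal.ofReal_mul (by positivity)]
      refine ENNReal.ofReal_le_ofReal ?_
      generalize hyy : x + (c i + η) = y at *
      rcases eq_or_ne x y with rfl | hne
      · simp
      · have h0 : 0 < ‖x - y‖ := norm_pos_iff.2 (sub_ne_zero.2 hne)
        have h1 : 0 < ‖x - y‖ ^ q := Real.rpow_pos_of_pos h0 q
        have h2 : ‖x - y‖ ^ q ≤ R ^ q := Real.rpow_le_rpow h0.le hn hq0.le
        rw [mul_div_assoc', le_div_iff₀ h1, mul_comm]
        exact mul_le_mul_of_nonneg_right h2 (abs_nonneg _)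
    · rw [indicator_of_notMem hη]; exact zero_le
  calc volume B * (N * ∫⁻ x in D, ENNReal.ofReal |w x|)
      = ∫⁻ η in B, N * ∫⁻ x in D, ENNReal.ofReal |w x| := by
        rw [setLIntegral_const, mul_comm]
    _ ≤ ∫⁻ η in B, ((∫⁻ x in D', ENNReal.ofReal |w x|) + ∑ i ∈ Finset.Icc 1 N, F i η) :=
        setLIntegral_mono' hB step1
    _ = volume B * (∫⁻ x in D', ENNReal.ofReal |w x|) + ∑ i ∈ Finset.Icc 1 N, ∫⁻ η in B, F i η := by
        rw [lintegral_add_left measurable_const, setLIntegral_const, mul_comm,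
          lintegral_finsetSum _ (fun i _ => hFm i)]
    _ ≤ _ := by
        gcongr
        refine (Finset.sum_le_sum step2).trans ?_
        simp

/-- A recursive inequality with contraction factor `Λ / N < 1` gives summability. -/
lemma tsum_le_of_recursion {b g : ℕ → ℝ≥0∞} {N Λ C : ℝ≥0∞} (hN : Λ + 1 ≤ N)
    (h : ∀ j, N * b (j + 1) ≤ Λ * b j + C * g j) :
    ∑' j, b j ≤ N * b 0 + C * ∑' j, g j := by
  -- Keeping the term N b(J) on the left makes the induction close: Λ + 1 ≤ N leaves one copy of
  -- b(J) for the sum after the recursion has used Λ of them.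
  have key : ∀ J, ∑ j ∈ Finset.range J, b j + N * b J ≤
      N * b 0 + C * ∑ j ∈ Finset.range J, g j := by
    intro J
    induction J with
    | zero => simp
    | succ J ih =>
      rw [Finset.sum_range_succ, Finset.sum_range_succ, mul_add, ← add_assoc]
      calc ∑ j ∈ Finset.range J, b j + b J + N * b (J + 1)
          ≤ ∑ j ∈ Finset.range J, b j + b J + (Λ * b J + C * g J) := by gcongr; exact h J
        _ = ∑ j ∈ Finset.range J, b j + (Λ + 1) * b J + C * g J := by ring
        _ ≤ ∑ j ∈ Finset.range J, b j + N * b J + C * g J := by gcongr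
        _ ≤ _ := by gcongr
  refine ENNReal.summable.tsum_le_of_sum_range_le fun J => ?_
  calc ∑ j ∈ Finset.range J, b j ≤ ∑ j ∈ Finset.range J, b j + N * b J := le_self_add
    _ ≤ _ := key J
    _ ≤ _ := by gcongr; exact ENNReal.sum_le_tsum _

/-- Sublinear growth of t ↦ t^s; this is where s < 1 enters the Hardy inequality. -/
lemma exists_nat_rpow_add_one_le {s : ℝ} (hs1 : s < 1) :
    ∃ N : ℕ, (2 * (N : ℝ) + 2) ^ s + 1 ≤ N := by
  have h1 : Filter.Tendsto (fun N : ℕ => (2 * (N : ℝ) + 2)) Filter.atTop Filter.atTop :=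
    Filter.tendsto_atTop_add_const_right _ _
      (tendsto_natCast_atTop_atTop.const_mul_atTop (by norm_num))
  have h2 := (tendsto_rpow_neg_atTop (y := 1 - s) (by linarith)).comp h1
  obtain ⟨N, hN, hN2⟩ := ((h2.eventually_le_const (u := (1 / 8 : ℝ)) (by norm_num)).and
    (Filter.eventually_ge_atTop 2)).exists
  refine ⟨N, ?_⟩
  simp only [Function.comp_apply, neg_sub] at hN
  have hN2' : (2 : ℝ) ≤ N := by exact_mod_cast hN2
  have h0 : (0 : ℝ) < 2 * N + 2 := by positivity
  have : (2 * (N : ℝ) + 2) ^ s = (2 * N + 2) * (2 * (N : ℝ) + 2) ^ (s - 1) := by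
    rw [Real.rpow_sub_one h0.ne']; field_simp
  rw [this]
  nlinarith

/-- The height of `x` over the graph of `g` in the direction `e`. -/
def graphHeight {n : ℕ} (e : EuclideanSpace ℝ (Fin n)) (g : EuclideanSpace ℝ (Fin n) → ℝ)
    (x : EuclideanSpace ℝ (Fin n)) : ℝ :=
  inner ℝ e x - g (x - inner ℝ e x • e)

lemma graphHeight_add_smul {n : ℕ} {e : EuclideanSpace ℝ (Fin n)} (he : ‖e‖ = 1)
    (g : EuclideanSpace ℝ (Fin n) → ℝ) (x : EuclideanSpace ℝ (Fin n)) (c : ℝ) :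
    graphHeight e g (x + c • e) = graphHeight e g x + c := by
  have h : inner ℝ e (x + c • e) = inner ℝ e x + c := by
    rw [inner_add_right, inner_smul_right, real_inner_self_eq_norm_sq, he]; ring
  unfold graphHeight
  rw [h, add_smul, add_sub_add_right_eq_sub]
  ring

lemma abs_graphHeight_sub_le {n : ℕ} {e : EuclideanSpace ℝ (Fin n)} (he : ‖e‖ = 1)
    {g : EuclideanSpace ℝ (Fin n) → ℝ} {K : ℝ≥0} (hg : LipschitzWith K g)
    (x y : EuclideanSpace ℝ (Fin n)) :
    |graphHeight e g x - graphHeight e g y| ≤ (1 + 2 * K) * ‖x - y‖ := by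
  have h1 : |inner ℝ e x - inner ℝ e y| ≤ ‖x - y‖ := by
    rw [← inner_sub_right]
    simpa [he] using abs_real_inner_le_norm e (x - y)
  have h2 : |g (x - inner ℝ e x • e) - g (y - inner ℝ e y • e)| ≤ K * (2 * ‖x - y‖) := by
    have := hg.dist_le_mul (x - inner ℝ e x • e) (y - inner ℝ e y • e)
    rw [Real.dist_eq, dist_eq_norm] at this
    refine this.trans (mul_le_mul_of_nonneg_left ?_ K.2)
    have e1 : x - inner ℝ e x • e - (y - inner ℝ e y • e)
        = (x - y) - (inner ℝ e x - inner ℝ e y) • e := by rw [sub_smul]; abel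
    rw [e1]
    refine (norm_sub_le _ _).trans ?_
    rw [norm_smul, he, Real.norm_eq_abs]
    linarith
  unfold graphHeight
  rw [abs_le] at *
  constructor <;> linarith [h1.1, h1.2, h2.1, h2.2]

lemma continuous_graphHeight {n : ℕ} (e : EuclideanSpace ℝ (Fin n))
    {g : EuclideanSpace ℝ (Fin n) → ℝ} {K : ℝ≥0} (hg : LipschitzWith K g) :
    Continuous (graphHeight e g) := by
  have := hg.continuous
  unfold graphHeight
  fun_prop

/-- The part of the ball `B(p, ρ + τ)` lying at heights in `(τ', τ]` over the graph of `g`. -/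
def graphLayer {n : ℕ} (e : EuclideanSpace ℝ (Fin n)) (g : EuclideanSpace ℝ (Fin n) → ℝ)
    (p : EuclideanSpace ℝ (Fin n)) (ρ τ' τ : ℝ) : Set (EuclideanSpace ℝ (Fin n)) :=
  Metric.ball p (ρ + τ) ∩ {x | τ' < graphHeight e g x ∧ graphHeight e g x ≤ τ}

lemma measurableSet_graphLayer {n : ℕ} (e : EuclideanSpace ℝ (Fin n))
    {g : EuclideanSpace ℝ (Fin n) → ℝ} {K : ℝ≥0} (hg : LipschitzWith K g)
    (p : EuclideanSpace ℝ (Fin n)) (ρ τ' τ : ℝ) : MeasurableSet (graphLayer e g p ρ τ' τ) := by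
  have hm := (continuous_graphHeight e hg).measurable
  exact Metric.isOpen_ball.measurableSet.inter
    ((measurableSet_lt measurable_const hm).inter (measurableSet_le hm measurable_const))

/-- One step of the Hardy recursion over layers, from the layer `(σ, τ]` to the layer
`(τ, (2N + 2) τ]`. -/
lemma graphLayer_recursion {n : ℕ} {s : ℝ} (hs : 0 < s)
    {w : EuclideanSpace ℝ (Fin n) → ℝ} (hw : Measurable w) {Ω : Set (EuclideanSpace ℝ (Fin n))}
    (hΩ : MeasurableSet Ω) {e : EuclideanSpace ℝ (Fin n)} (he : ‖e‖ = 1)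
    {g : EuclideanSpace ℝ (Fin n) → ℝ} {K : ℝ≥0} (hg : LipschitzWith K g)
    {p : EuclideanSpace ℝ (Fin n)} {ρ σ τ : ℝ} (hσ : 0 < σ) (hτ : 0 < τ) (N : ℕ)
    (hsub : graphLayer e g p ρ τ ((2 * N + 2) * τ) ⊆ Ω) :
    N * (ENNReal.ofReal (τ ^ (-s)) * ∫⁻ x in graphLayer e g p ρ σ τ, ENNReal.ofReal |w x|) ≤
      ENNReal.ofReal ((2 * N + 2) ^ s) * (ENNReal.ofReal (((2 * N + 2) * τ) ^ (-s)) *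
        ∫⁻ x in graphLayer e g p ρ τ ((2 * N + 2) * τ), ENNReal.ofReal |w x|) +
      ((volume (Metric.ball (0 : EuclideanSpace ℝ (Fin n)) (1 / (2 * (1 + 2 * K)))))⁻¹ * N *
        ENNReal.ofReal ((2 * N + 1) ^ ((n : ℝ) + s))) *
        ∫⁻ x in graphLayer e g p ρ σ τ, ∫⁻ y in Ω,
          ENNReal.ofReal (|w x - w y| / ‖x - y‖ ^ ((n : ℝ) + s)) := by
  set lip : ℝ := 1 + 2 * K with hlip
  have hL1 : 1 ≤ lip := by have := K.2; simp only [hlip]; linarith [K.coe_nonneg]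
  set V := volume (Metric.ball (0 : EuclideanSpace ℝ (Fin n)) (1 / (2 * lip))) with hV
  set q : ℝ := (n : ℝ) + s with hq
  have hρ0 : 0 < 1 / (2 * lip) := by positivity
  have hV0 : V ≠ 0 := (Metric.measure_ball_pos volume _ hρ0).ne'
  have hVt : V ≠ ∞ := measure_ball_lt_top.ne
  have hsmall : ∀ η ∈ Metric.ball (0 : EuclideanSpace ℝ (Fin n)) (τ * (1 / (2 * lip))),
      lip * ‖η‖ < τ / 2 ∧ ‖η‖ ≤ τ := by
    intro η hη
    rw [mem_ball_zero_iff] at hη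
    have h1 : lip * ‖η‖ < τ / 2 := by
      have : lip * ‖η‖ < lip * (τ * (1 / (2 * lip))) := by gcongr
      refine this.trans_eq ?_
      field_simp
    exact ⟨h1, by nlinarith [norm_nonneg η]⟩
  -- Shift upwards by 2iτ, 1 ≤ i ≤ N. The spacing 2τ exceeds the layer's thickness, so translates
  -- are disjoint. A perturbation shorter than τ/(2 lip) changes heights by less than τ/2, so they
  -- stay in (τ, (2N + 2)τ]. The displacement is at most (2N + 1)τ, which the wider ball of the
  -- target layer absorbs.
  have key := card_mul_setLIntegral_le_of_translates (s := s) hs hw (Ω := Ω)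
    (D := graphLayer e g p ρ σ τ) (D' := graphLayer e g p ρ τ ((2 * N + 2) * τ))
    (B := Metric.ball 0 (τ * (1 / (2 * lip)))) hΩ (measurableSet_graphLayer e hg _ _ _ _)
    Metric.isOpen_ball.measurableSet hsub N (fun i => (2 * i * τ) • e)
    (R := (2 * N + 1) * τ) ?_ ?_ ?_
  · have hvol : volume (Metric.ball (0 : EuclideanSpace ℝ (Fin n)) (τ * (1 / (2 * lip))))
        = ENNReal.ofReal (τ ^ n) * V := by
      rw [Measure.addHaar_ball_mul_of_pos _ _ hτ, finrank_euclideanSpace_fin]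
    rw [hvol] at key
    set a := ∫⁻ x in graphLayer e g p ρ σ τ, ENNReal.ofReal |w x|
    set a' := ∫⁻ x in graphLayer e g p ρ τ ((2 * N + 2) * τ), ENNReal.ofReal |w x|
    set G := ∫⁻ x in graphLayer e g p ρ σ τ, ∫⁻ y in Ω,
          ENNReal.ofReal (|w x - w y| / ‖x - y‖ ^ q)
    have hVV : V⁻¹ * V = 1 := ENNReal.inv_mul_cancel hV0 hVt
    have hT1 : ENNReal.ofReal (τ ^ (-q)) * ENNReal.ofReal (τ ^ n) = ENNReal.ofReal (τ ^ (-s)) := by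
      rw [← ENNReal.ofReal_mul (by positivity), ← Real.rpow_natCast, ← Real.rpow_add hτ]
      congr 2; simp [hq]
    have hT2 : ENNReal.ofReal (τ ^ (-q)) * ENNReal.ofReal (((2 * N + 1) * τ) ^ q)
        = ENNReal.ofReal ((2 * N + 1) ^ q) := by
      rw [← ENNReal.ofReal_mul (by positivity), Real.mul_rpow (by positivity) hτ.le,
        Real.rpow_neg hτ.le]
      congr 1
      have : τ ^ q ≠ 0 := (Real.rpow_pos_of_pos hτ q).ne'
      field_simp
    have hT3 : ENNReal.ofReal ((2 * N + 2) ^ s) * ENNReal.ofReal (((2 * N + 2) * τ) ^ (-s))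
        = ENNReal.ofReal (τ ^ (-s)) := by
      rw [← ENNReal.ofReal_mul (by positivity), Real.mul_rpow (by positivity) hτ.le,
        Real.rpow_neg (by positivity)]
      congr 1
      have : ((2 * N + 2 : ℝ)) ^ s ≠ 0 := (Real.rpow_pos_of_pos (by positivity) s).ne'
      field_simp
    calc N * (ENNReal.ofReal (τ ^ (-s)) * a)
        = V⁻¹ * ENNReal.ofReal (τ ^ (-q)) * (ENNReal.ofReal (τ ^ n) * V * (N * a)) := by
          rw [← hT1, ← one_mul (_ * (_ * a)), ← hVV]; ring
      _ ≤ V⁻¹ * ENNReal.ofReal (τ ^ (-q)) * (ENNReal.ofReal (τ ^ n) * V * a' +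
            N * (ENNReal.ofReal (((2 * N + 1) * τ) ^ q) * G)) := by gcongr
      _ = (V⁻¹ * V) * (ENNReal.ofReal (τ ^ (-q)) * ENNReal.ofReal (τ ^ n)) * a' +
            (V⁻¹ * N * (ENNReal.ofReal (τ ^ (-q)) * ENNReal.ofReal (((2 * N + 1) * τ) ^ q))) * G := by
          ring
      _ = _ := by rw [hVV, hT1, hT2, one_mul, ← hT3, mul_assoc]
  · rintro i hi η hη x ⟨hx1, hx2, hx3⟩
    rw [Finset.mem_Icc] at hi
    have hi1 : (1 : ℝ) ≤ i := by exact_mod_cast hi.1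
    have hiN : (i : ℝ) ≤ N := by exact_mod_cast hi.2
    obtain ⟨h1, h2⟩ := hsmall η hη
    have h3 := abs_graphHeight_sub_le he hg (x + η + (2 * i * τ) • e) (x + (2 * i * τ) • e)
    rw [show x + η + (2 * i * τ) • e - (x + (2 * i * τ) • e) = η by abel,
      graphHeight_add_smul he g x] at h3
    have h4 : x + ((2 * i * τ) • e + η) = x + η + (2 * i * τ) • e := by abel
    rw [abs_le] at h3
    have hiτ : τ ≤ i * τ := by nlinarith
    have hiNτ : i * τ ≤ N * τ := by nlinarith
    refine ⟨?_, ?_, ?_⟩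
    · rw [Metric.mem_ball, dist_eq_norm] at hx1 ⊢
      have h5 : ‖x + ((2 * i * τ) • e + η) - p‖ ≤ ‖x - p‖ + (‖(2 * i * τ) • e‖ + ‖η‖) := by
        rw [show x + ((2 * i * τ) • e + η) - p = (x - p) + ((2 * i * τ) • e + η) by abel]
        exact (norm_add_le _ _).trans (by gcongr; exact norm_add_le _ _)
      rw [norm_smul, he, Real.norm_of_nonneg (by positivity)] at h5
      nlinarith
    · rw [h4]; nlinarith [h3.1]
    · rw [h4]; nlinarith [h3.2]
  · rintro i hi j hj hij x ⟨hx1, hx2, hx3⟩ y ⟨hy1, hy2, hy3⟩ hxy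
    have h := congrArg (graphHeight e g) hxy
    rw [graphHeight_add_smul he, graphHeight_add_smul he] at h
    rcases lt_or_gt_of_ne hij with hlt | hlt
    · have : (i : ℝ) + 1 ≤ j := by exact_mod_cast hlt
      nlinarith
    · have : (j : ℝ) + 1 ≤ i := by exact_mod_cast hlt
      nlinarith
  · intro i hi η hη
    rw [Finset.mem_Icc] at hi
    have hiN : (i : ℝ) ≤ N := by exact_mod_cast hi.2
    obtain ⟨h1, h2⟩ := hsmall η hη
    refine (norm_add_le _ _).trans ?_
    rw [norm_smul, he, Real.norm_of_nonneg (by positivity)]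
    nlinarith

/-- The fractional Hardy inequality near a boundary point where the domain is a Lipschitz
epigraph. -/
lemma exists_ball_lintegral_kernelPotential_lt_top_of_epigraph {n : ℕ} {s : ℝ} (hs0 : 0 < s)
    (hs1 : s < 1) {w : EuclideanSpace ℝ (Fin n) → ℝ} (hw : Measurable w)
    {Ω : Set (EuclideanSpace ℝ (Fin n))} (hΩ : MeasurableSet Ω)
    (hwi : ∫⁻ x in Ω, ENNReal.ofReal |w x| < ∞) (hwG : gagliardoSeminorm s Ω w < ∞)
    {p : EuclideanSpace ℝ (Fin n)} (hp : p ∉ Ω) {e : EuclideanSpace ℝ (Fin n)} (he : ‖e‖ = 1)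
    {r : ℝ} (hr : 0 < r) {g : EuclideanSpace ℝ (Fin n) → ℝ} {K : ℝ≥0} (hg : LipschitzWith K g)
    (hep : ∀ x ∈ Metric.ball p r, (x ∈ Ω ↔ 0 < graphHeight e g x)) :
    ∃ ε > 0, ∫⁻ x in Metric.ball p ε ∩ Ω,
      ENNReal.ofReal |w x| * kernelPotential s Ωᶜ x < ∞ := by
  set lip : ℝ := 1 + 2 * K with hlip
  have hL1 : 1 ≤ lip := by simp only [hlip]; linarith [K.coe_nonneg]
  obtain ⟨N, hN⟩ := exists_nat_rpow_add_one_le hs1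
  set lam : ℝ := 2 * N + 2 with hlam
  have hlam1 : 1 < lam := by
    have : (0 : ℝ) ≤ N := by positivity
    simp only [hlam]; linarith
  -- The ratio 2N + 2 is that of the recursion, so the layer above `D (j + 1)` is exactly `D j`.
  set τ : ℕ → ℝ := fun j => r / 2 * lam⁻¹ ^ j with hτ
  have hτ0 : ∀ j, 0 < τ j := fun j => by simp only [hτ]; positivity
  have hτs : ∀ j, lam * τ (j + 1) = τ j := fun j => by
    simp only [hτ, pow_succ]; field_simp
  have hτanti : Antitone τ := antitone_nat_of_succ_le fun j => by
    rw [← hτs j]; nlinarith [hτ0 (j + 1)]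
  have hτr : ∀ j, τ j ≤ r / 2 := fun j => by
    have := hτanti (Nat.zero_le j)
    simpa [hτ] using this
  set D : ℕ → Set (EuclideanSpace ℝ (Fin n)) := fun j => graphLayer e g p (r / 2) (τ (j + 1)) (τ j)
    with hD
  have hDm : ∀ j, MeasurableSet (D j) := fun j => measurableSet_graphLayer e hg _ _ _ _
  have hDΩ : ∀ j, D j ⊆ Ω := by
    rintro j x ⟨hx1, hx2, hx3⟩
    rw [hep x (Metric.ball_subset_ball (by linarith [hτr j]) hx1)]
    exact (hτ0 _).trans hx2
  have hDdisj : Pairwise (Function.onFun Disjoint D) := by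
    have aux : ∀ i j, i < j → Disjoint (D i) (D j) := by
      intro i j hij
      refine Set.disjoint_left.2 ?_
      rintro x ⟨_, hx, _⟩ ⟨_, _, hx'⟩
      exact absurd (hx'.trans (hτanti hij)) (not_le.2 hx)
    intro i j hij
    rcases lt_or_gt_of_ne hij with h | h
    · exact aux i j h
    · exact (aux j i h).symm
  set b : ℕ → ℝ≥0∞ := fun j => ENNReal.ofReal (τ j ^ (-s)) * ∫⁻ x in D j, ENNReal.ofReal |w x|
  set G : ℕ → ℝ≥0∞ := fun j => ∫⁻ x in D (j + 1), ∫⁻ y in Ω,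
    ENNReal.ofReal (|w x - w y| / ‖x - y‖ ^ ((n : ℝ) + s))
  set C : ℝ≥0∞ := (volume (Metric.ball (0 : EuclideanSpace ℝ (Fin n)) (1 / (2 * lip))))⁻¹ * N *
        ENNReal.ofReal ((2 * N + 1) ^ ((n : ℝ) + s)) with hC
  have hCt : C < ∞ := by
    refine ENNReal.mul_lt_top (ENNReal.mul_lt_top ?_ (by simp)) ENNReal.ofReal_lt_top
    exact ENNReal.inv_lt_top.2 (Metric.measure_ball_pos volume _ (by positivity))
  have hrec : ∀ j, N * b (j + 1) ≤ ENNReal.ofReal (lam ^ s) * b j + C * G j := by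
    intro j
    have h := graphLayer_recursion hs0 hw hΩ he hg (p := p) (ρ := r / 2) (hτ0 (j + 2))
      (hτ0 (j + 1)) N (by rw [← hlam, hτs j]; exact hDΩ j)
    rw [← hlam, hτs j] at h
    exact h
  have hG : ∑' j, G j < ∞ := by
    refine lt_of_le_of_lt ?_ hwG
    have : ∑' j, G j = ∫⁻ x in ⋃ j, D (j + 1), ∫⁻ y in Ω,
        ENNReal.ofReal (|w x - w y| / ‖x - y‖ ^ ((n : ℝ) + s)) :=
      (lintegral_iUnion (fun j => hDm (j + 1))
        (fun i j hij => hDdisj (fun h => hij (by omega))) _).symm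
    rw [this]
    exact lintegral_mono_set (iUnion_subset fun j => hDΩ _)
  have hb : ∑' j, b j < ∞ := by
    refine lt_of_le_of_lt (tsum_le_of_recursion (N := N) (Λ := ENNReal.ofReal (lam ^ s)) ?_ hrec) ?_
    · rw [← ENNReal.ofReal_one, ← ENNReal.ofReal_add (by positivity) (by norm_num),
        ← ENNReal.ofReal_natCast]
      exact ENNReal.ofReal_le_ofReal hN
    · refine ENNReal.add_lt_top.2 ⟨ENNReal.mul_lt_top (by simp)
        (ENNReal.mul_lt_top ENNReal.ofReal_lt_top ?_), ENNReal.mul_lt_top hCt hG⟩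
      exact (lintegral_mono_set (hDΩ 0)).trans_lt hwi
  set M : ℝ≥0∞ := ENNReal.ofReal ((lam * lip) ^ s) * kernelTail n s 1 with hM
  have hMt : M < ∞ := ENNReal.mul_lt_top ENNReal.ofReal_lt_top (kernelTail_one_lt_top n hs0)
  -- Height is Lipschitz with constant `lip`, so a point higher than τ (j + 1) is at distance at
  -- least τ (j + 1) / lip from the complement. The potential is then at most a kernel tail, of
  -- order τ j ^ (-s).
  have hpot : ∀ j, ∀ x ∈ D j ∩ Metric.ball p (r / 2),
      kernelPotential s Ωᶜ x ≤ M * ENNReal.ofReal (τ j ^ (-s)) := by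
    rintro j x ⟨⟨hx1, hx2, hx3⟩, hx4⟩
    have h1 : kernelPotential s Ωᶜ x ≤ kernelTail n s (τ (j + 1) / lip) := by
      refine kernelPotential_le_kernelTail s fun y hy => ?_
      by_contra hlt
      push Not at hlt
      refine hy ((hep y ?_).2 ?_)
      · rw [Metric.mem_ball] at hx4 ⊢
        have h2 : τ (j + 1) / lip ≤ τ (j + 1) := div_le_self (hτ0 _).le hL1
        have h3 := dist_triangle y x p
        rw [dist_comm y x, dist_eq_norm x y] at h3
        linarith [hτr (j + 1)]
      · have h2 := (abs_le.1 (abs_graphHeight_sub_le he hg x y)).2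
        rw [lt_div_iff₀ (by positivity), mul_comm] at hlt
        linarith
    refine h1.trans (le_of_eq ?_)
    rw [kernelTail_eq n s (by have := hτ0 (j + 1); positivity), hM, mul_right_comm]
    congr 1
    rw [← ENNReal.ofReal_mul (by positivity)]
    congr 1
    have h2 : τ (j + 1) / lip = (lam * lip)⁻¹ * τ j := by rw [← hτs j]; field_simp
    rw [h2, Real.mul_rpow (by positivity) (hτ0 j).le, Real.inv_rpow (by positivity),
      ← Real.rpow_neg (by positivity), neg_neg]
  have hpt : graphHeight e g p ≤ 0 := by
    by_contra h
    exact hp ((hep p (Metric.mem_ball_self hr)).2 (not_le.1 h))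
  -- The centre has height at most 0, so this radius keeps heights below r / 2 = τ 0 and the layers
  -- cover the part of the ball in Ω.
  refine ⟨r / (2 * lip), by positivity, ?_⟩
  have hcover : Metric.ball p (r / (2 * lip)) ∩ Ω ⊆ ⋃ j, D j ∩ Metric.ball p (r / 2) := by
    rintro x ⟨hx, hxΩ⟩
    have hx2 : x ∈ Metric.ball p (r / 2) := by
      refine Metric.ball_subset_ball ?_ hx
      rw [div_le_div_iff₀ (by positivity) (by positivity)]; nlinarith
    have hx0 : 0 < graphHeight e g x :=
      (hep x (Metric.ball_subset_ball (by linarith) hx2)).1 hxΩ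
    have hx1 : graphHeight e g x ≤ r / 2 := by
      have h2 := (abs_le.1 (abs_graphHeight_sub_le he hg x p)).2
      rw [Metric.mem_ball, dist_eq_norm, lt_div_iff₀ (by positivity)] at hx
      nlinarith
    obtain ⟨j, hj1, hj2⟩ := exists_nat_pow_near_of_lt_one (x := graphHeight e g x / (r / 2))
      (y := lam⁻¹) (by positivity) (by rw [div_le_one (by positivity)]; exact hx1) (by positivity)
      (inv_lt_one_of_one_lt₀ hlam1)
    rw [lt_div_iff₀ (by positivity), mul_comm] at hj1
    rw [div_le_iff₀ (by positivity), mul_comm] at hj2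
    refine mem_iUnion.2 ⟨j, ⟨Metric.ball_subset_ball ?_ hx2, hj1, hj2⟩, hx2⟩
    linarith [hτ0 j]
  calc ∫⁻ x in Metric.ball p (r / (2 * lip)) ∩ Ω, ENNReal.ofReal |w x| * kernelPotential s Ωᶜ x
      ≤ ∫⁻ x in ⋃ j, D j ∩ Metric.ball p (r / 2), ENNReal.ofReal |w x| * kernelPotential s Ωᶜ x :=
        lintegral_mono_set hcover
    _ ≤ ∑' j, ∫⁻ x in D j ∩ Metric.ball p (r / 2), ENNReal.ofReal |w x| * kernelPotential s Ωᶜ x :=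
        lintegral_iUnion_le _ _
    _ ≤ ∑' j, M * b j := by
        refine ENNReal.tsum_le_tsum fun j => ?_
        calc ∫⁻ x in D j ∩ Metric.ball p (r / 2), ENNReal.ofReal |w x| * kernelPotential s Ωᶜ x
            ≤ ∫⁻ x in D j ∩ Metric.ball p (r / 2),
                M * ENNReal.ofReal (τ j ^ (-s)) * ENNReal.ofReal |w x| := by
              refine setLIntegral_mono' ((hDm j).inter Metric.isOpen_ball.measurableSet)
                fun x hx => ?_
              rw [mul_comm]
              gcongr
              exact hpot j x hx
          _ ≤ ∫⁻ x in D j, M * ENNReal.ofReal (τ j ^ (-s)) * ENNReal.ofReal |w x| :=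
              lintegral_mono_set inter_subset_left
          _ = M * b j := by rw [lintegral_const_mul _ (by fun_prop), mul_assoc]
    _ = M * ∑' j, b j := ENNReal.tsum_mul_left
    _ < ∞ := ENNReal.mul_lt_top hMt hb

/-- The fractional Hardy inequality on bounded Lipschitz domains, in qualitative form. -/
theorem lintegral_abs_mul_kernelPotential_compl_lt_top {n : ℕ} {s : ℝ} (hs0 : 0 < s)
    (hs1 : s < 1) {Ω : Set (EuclideanSpace ℝ (Fin n))} (hΩ : IsOpen Ω)
    (hb : Bornology.IsBounded Ω) (hL : HasLipschitzBoundary Ω)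
    {w : EuclideanSpace ℝ (Fin n) → ℝ} (hw : w ∈ sobolevSpaceW s Ω) :
    ∫⁻ x in Ω, ENNReal.ofReal |w x| * kernelPotential s Ωᶜ x < ∞ := by
  obtain ⟨hwm, hwi, hwG⟩ := hw
  -- The translation argument needs a Borel representative; no integral here sees the change.
  set w' := hwm.mk w with hw'
  have hae : w =ᵐ[volume] w' := hwm.ae_eq_mk
  have hwm' : Measurable w' := hwm.measurable_mk
  have hwi' : ∫⁻ x in Ω, ENNReal.ofReal |w' x| < ∞ := by
    have := hwi.congr (ae_restrict_of_ae hae)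
    have h2 := this.2
    rw [hasFiniteIntegral_iff_norm] at h2
    simpa only [Real.norm_eq_abs] using h2
  have hwG' : gagliardoSeminorm s Ω w' < ∞ := by
    convert hwG using 1
    unfold gagliardoSeminorm
    refine lintegral_congr_ae (ae_restrict_of_ae ?_)
    filter_upwards [hae] with x hx
    refine lintegral_congr_ae (ae_restrict_of_ae ?_)
    filter_upwards [hae] with y hy
    rw [hx, hy]
  have hcongr : ∫⁻ x in Ω, ENNReal.ofReal |w x| * kernelPotential s Ωᶜ x
      = ∫⁻ x in Ω, ENNReal.ofReal |w' x| * kernelPotential s Ωᶜ x := by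
    refine lintegral_congr_ae (ae_restrict_of_ae ?_)
    filter_upwards [hae] with x hx
    rw [hx]
  rw [hcongr]
  have hcpt : IsCompact (closure Ω) := hb.isCompact_closure
  -- Finiteness is a local property on the compact closure. At interior points the potential is
  -- bounded; boundary points use the epigraph case.
  have main : ∫⁻ x in closure Ω ∩ Ω, ENNReal.ofReal |w' x| * kernelPotential s Ωᶜ x < ∞ := by
    refine hcpt.induction_on (p := fun A => ∫⁻ x in A ∩ Ω, ENNReal.ofReal |w' x| *
      kernelPotential s Ωᶜ x < ∞) (by simp) ?_ ?_ ?_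
    · intro A B hAB hB
      exact (lintegral_mono_set (inter_subset_inter_left _ hAB)).trans_lt hB
    · intro A B hA hB
      rw [union_inter_distrib_right]
      exact (lintegral_union_le _ _ _).trans_lt (ENNReal.add_lt_top.2 ⟨hA, hB⟩)
    · intro p hp
      suffices h : ∃ ε > 0, ∫⁻ x in Metric.ball p ε ∩ Ω,
          ENNReal.ofReal |w' x| * kernelPotential s Ωᶜ x < ∞ by
        obtain ⟨ε, hε, h⟩ := h
        exact ⟨_, mem_nhdsWithin_of_mem_nhds (Metric.ball_mem_nhds p hε), h⟩
      by_cases hpΩ : p ∈ Ω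
      · obtain ⟨δ, hδ, hball⟩ := Metric.isOpen_iff.1 hΩ p hpΩ
        refine ⟨δ / 2, by positivity, ?_⟩
        calc ∫⁻ x in Metric.ball p (δ / 2) ∩ Ω, ENNReal.ofReal |w' x| * kernelPotential s Ωᶜ x
            ≤ ∫⁻ x in Metric.ball p (δ / 2) ∩ Ω, ENNReal.ofReal |w' x| * kernelTail n s (δ / 2) := by
              refine setLIntegral_mono' (Metric.isOpen_ball.inter hΩ).measurableSet fun x hx => ?_
              gcongr
              refine kernelPotential_le_kernelTail s fun y hy => ?_
              by_contra hlt
              push Not at hlt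
              refine hy (hball ?_)
              have hx1 := hx.1
              rw [Metric.mem_ball] at hx1 ⊢
              have h3 := dist_triangle y x p
              rw [dist_comm y x, dist_eq_norm x y] at h3
              linarith
          _ ≤ ∫⁻ x in Ω, ENNReal.ofReal |w' x| * kernelTail n s (δ / 2) :=
              lintegral_mono_set inter_subset_right
          _ = (∫⁻ x in Ω, ENNReal.ofReal |w' x|) * kernelTail n s (δ / 2) :=
              lintegral_mul_const _ (by fun_prop)
          _ < ∞ := ENNReal.mul_lt_top hwi' (kernelTail_lt_top n hs0 (by positivity))
      · have hfr : p ∈ frontier Ω := ⟨hp, by rwa [hΩ.interior_eq]⟩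
        obtain ⟨e, r, K, g, he, hr, hg, hep⟩ := hL p hfr
        refine exists_ball_lintegral_kernelPotential_lt_top_of_epigraph hs0 hs1 hwm'
          hΩ.measurableSet hwi' hwG' hpΩ he hr hg fun x hx => ?_
        rw [hep x hx, graphHeight, sub_pos]
  rwa [inter_eq_self_of_subset_right subset_closure] at main

/-! ### The direct method by convexity, without compactness. -/

/-- A quantitative strict convexity estimate for `t ↦ √(1 + t²)`. -/
lemma sq_sub_le_convexity_gap_sqrt (a b : ℝ) :
    (a - b) ^ 2 ≤ ((√(1 + a ^ 2) + √(1 + b ^ 2)) / 2 - √(1 + ((a + b) / 2) ^ 2)) *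
      (√(1 + a ^ 2) + √(1 + b ^ 2)) ^ 3 := by
  set A := √(1 + a ^ 2) with hA
  set B := √(1 + b ^ 2) with hB
  set M := √(1 + ((a + b) / 2) ^ 2) with hM
  have hA2 : A ^ 2 = 1 + a ^ 2 := Real.sq_sqrt (by positivity)
  have hB2 : B ^ 2 = 1 + b ^ 2 := Real.sq_sqrt (by positivity)
  have hM2 : M ^ 2 = 1 + ((a + b) / 2) ^ 2 := Real.sq_sqrt (by positivity)
  have hA0 : 0 < A := Real.sqrt_pos.2 (by positivity)
  have hB0 : 0 < B := Real.sqrt_pos.2 (by positivity)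
  have hM0 : 0 < M := Real.sqrt_pos.2 (by positivity)
  have h1 : 1 + a * b ≤ A * B := by
    refine le_of_sq_le_sq ?_ (by positivity)
    rw [mul_pow, hA2, hB2]
    nlinarith [sq_nonneg (a - b)]
  have h2 : M ≤ (A + B) / 2 := by
    refine le_of_sq_le_sq ?_ (by positivity)
    nlinarith
  -- Rationalise twice: the gap times (A + B)/2 + M is half of AB - (1 + ab), and the latter times
  -- its conjugate is (a - b)².
  have e1 : ((A + B) / 2 - M) * ((A + B) / 2 + M) = (A * B - (1 + a * b)) / 2 := by
    nlinarith
  have e2 : (A * B - (1 + a * b)) * (A * B + (1 + a * b)) = (a - b) ^ 2 := by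
    have : (A * B) ^ 2 = (1 + a ^ 2) * (1 + b ^ 2) := by rw [mul_pow, hA2, hB2]
    nlinarith
  have h3 : 0 ≤ (A + B) / 2 - M := by linarith
  have h4 : A * B - (1 + a * b) ≤ 2 * (((A + B) / 2 - M) * (A + B)) := by nlinarith
  have h5 : A * B + (1 + a * b) ≤ (A + B) ^ 2 / 2 := by nlinarith [sq_nonneg (A - B)]
  rw [← e2]
  have h6 : 0 ≤ A * B - (1 + a * b) := by linarith
  calc (A * B - (1 + a * b)) * (A * B + (1 + a * b))
      ≤ (A * B - (1 + a * b)) * ((A + B) ^ 2 / 2) := by gcongr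
    _ ≤ 2 * (((A + B) / 2 - M) * (A + B)) * ((A + B) ^ 2 / 2) := by gcongr
    _ = _ := by ring

/-- Let W be the sum of the two square roots. Either √|a - b| ≤ lW, or W < √|a - b| / l, and then
the bound (a - b)² ≤ gap · W³ gives √|a - b| ≤ gap / l³. The linear growth of W allows integration
under an L¹ bound only. -/
lemma sqrt_abs_sub_le_convexity_gap (a b : ℝ) {l : ℝ} (hl : 0 < l) :
    √|a - b| ≤ l * (√(1 + a ^ 2) + √(1 + b ^ 2)) + (l ^ 3)⁻¹ *
      ((√(1 + a ^ 2) + √(1 + b ^ 2)) / 2 - √(1 + ((a + b) / 2) ^ 2)) := by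
  have h := sq_sub_le_convexity_gap_sqrt a b
  set W := √(1 + a ^ 2) + √(1 + b ^ 2) with hW
  set γ := W / 2 - √(1 + ((a + b) / 2) ^ 2) with hγ
  set x := √|a - b| with hx
  have hW0 : 0 < W := by
    have := Real.sqrt_pos.2 (show 0 < 1 + a ^ 2 by positivity)
    have := Real.sqrt_nonneg (1 + b ^ 2)
    simp only [hW]; linarith
  have hγ0 : 0 ≤ γ := by
    by_contra hneg
    push Not at hneg
    nlinarith [sq_nonneg (a - b), pow_pos hW0 3]
  have hx0 : 0 ≤ x := Real.sqrt_nonneg _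
  have hx4 : x ^ 4 = (a - b) ^ 2 := by
    rw [show x ^ 4 = (x ^ 2) ^ 2 by ring, hx, Real.sq_sqrt (abs_nonneg _), sq_abs]
  by_cases hc : x ≤ l * W
  · have : 0 ≤ (l ^ 3)⁻¹ * γ := by positivity
    linarith
  · push Not at hc
    have hx1 : 0 < x := lt_of_le_of_lt (by positivity) hc
    have h3 : (l * W) ^ 3 ≤ x ^ 3 := by gcongr
    have h4 : l ^ 3 * x ^ 4 ≤ γ * x ^ 3 := by
      calc l ^ 3 * x ^ 4 ≤ l ^ 3 * (γ * W ^ 3) := by rw [hx4]; gcongr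
        _ = γ * (l * W) ^ 3 := by ring
        _ ≤ γ * x ^ 3 := by gcongr
    have h5 : l ^ 3 * x ≤ γ := by
      have : l ^ 3 * x * x ^ 3 ≤ γ * x ^ 3 := by nlinarith
      exact le_of_mul_le_mul_right this (by positivity)
    have h6 : x ≤ (l ^ 3)⁻¹ * γ := by
      rw [inv_mul_eq_div, le_div_iff₀ (by positivity)]; linarith
    have : 0 ≤ l * W := by positivity
    linarith

lemma sqrt_one_add_sq_le (a : ℝ) : √(1 + a ^ 2) ≤ 1 + |a| := by
  rw [Real.sqrt_le_left (by positivity)]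
  nlinarith [abs_nonneg a, sq_abs a]

lemma integrable_sqrt_one_add_sq {X : Type*} [MeasurableSpace X] {μ : Measure X}
    [IsFiniteMeasure μ] {u : X → ℝ} (hu : Integrable u μ) :
    Integrable (fun x => √(1 + u x ^ 2)) μ := by
  refine Integrable.mono' ((integrable_const (1 : ℝ)).add hu.abs) ?_ ?_
  · exact (Real.continuous_sqrt.comp_aestronglyMeasurable
      ((hu.aestronglyMeasurable.pow 2).const_add 1))
  · refine Filter.Eventually.of_forall fun x => ?_
    rw [Real.norm_of_nonneg (Real.sqrt_nonneg _)]
    exact sqrt_one_add_sq_le _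

lemma integrable_sqrt_abs {X : Type*} [MeasurableSpace X] {μ : Measure X}
    [IsFiniteMeasure μ] {u : X → ℝ} (hu : Integrable u μ) :
    Integrable (fun x => √|u x|) μ := by
  refine Integrable.mono' ((integrable_const (1 : ℝ)).add hu.abs) ?_ ?_
  · exact Real.continuous_sqrt.comp_aestronglyMeasurable
      (continuous_abs.comp_aestronglyMeasurable hu.aestronglyMeasurable)
  · refine Filter.Eventually.of_forall fun x => ?_
    rw [Real.norm_of_nonneg (Real.sqrt_nonneg _)]
    change √|u x| ≤ 1 + |u x|
    rw [Real.sqrt_le_left (by positivity)]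
    nlinarith [abs_nonneg (u x)]

/-- A sequence of functions that is Cauchy for `∫ √|f - g|` has an almost everywhere convergent
subsequence. -/
lemma exists_subseq_ae_tendsto_of_integral_sqrt {X : Type*} [MeasurableSpace X] {μ : Measure X}
    [IsFiniteMeasure μ] {u : ℕ → X → ℝ} (hu : ∀ k, Integrable (u k) μ)
    (hC : ∀ δ > 0, ∃ k₀, ∀ k ≥ k₀, ∀ l ≥ k, ∫ x, √|u k x - u l x| ∂μ ≤ δ) :
    ∃ ψ : ℕ → ℕ, StrictMono ψ ∧
      ∀ᵐ x ∂μ, ∃ y, Filter.Tendsto (fun k => u (ψ k) x) Filter.atTop (nhds y) := by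
  have hC' : ∀ m : ℕ, ∀ᶠ k in Filter.atTop, ∀ l ≥ k,
      ∫ x, √|u k x - u l x| ∂μ ≤ (1 / 2 : ℝ) ^ m := by
    intro m
    obtain ⟨k₀, hk⟩ := hC ((1 / 2 : ℝ) ^ m) (by positivity)
    exact Filter.eventually_atTop.2 ⟨k₀, hk⟩
  obtain ⟨ψ, hψ, hψ2⟩ := Filter.extraction_forall_of_eventually hC'
  refine ⟨ψ, hψ, ?_⟩
  have hint : ∀ k, Integrable (fun x => √|u (ψ k) x - u (ψ (k + 1)) x|) μ := fun k =>
    integrable_sqrt_abs ((hu _).sub (hu _))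
  have hle : ∀ k, ∫ x, √|u (ψ k) x - u (ψ (k + 1)) x| ∂μ ≤ (1 / 2 : ℝ) ^ k := fun k =>
    hψ2 k _ (hψ (Nat.lt_succ_self k)).le
  have hae : ∀ᵐ x ∂μ, Summable fun k => √|u (ψ k) x - u (ψ (k + 1)) x| := by
    have h := summable_norm_of_tsum_eLpNorm_ne_top (μ := μ) le_rfl
      (fun k => (hint k).aestronglyMeasurable) ?_
    · simpa only [Real.norm_of_nonneg (Real.sqrt_nonneg _)] using h
    · refine ne_top_of_le_ne_top
        (summable_geometric_two.tsum_ofReal_ne_top) (ENNReal.tsum_le_tsum fun k => ?_)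
      rw [eLpNorm_one_eq_lintegral_enorm, ← ofReal_integral_norm_eq_lintegral_enorm (hint k)]
      refine ENNReal.ofReal_le_ofReal ?_
      simpa only [Real.norm_of_nonneg (Real.sqrt_nonneg _)] using hle k
  filter_upwards [hae] with x hx
  have hx2 : Summable fun k => dist (u (ψ k) x) (u (ψ (k + 1)) x) := by
    -- Once √|d| ≤ 1, |d| ≤ √|d|.
    refine summable_of_isBigO_nat hx ?_
    refine Asymptotics.IsBigO.of_bound 1 ?_
    filter_upwards [hx.tendsto_atTop_zero.eventually_le_const one_pos] with k hk
    rw [Real.dist_eq, Real.norm_of_nonneg (abs_nonneg _), Real.norm_of_nonneg (Real.sqrt_nonneg _),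
      one_mul]
    nlinarith [Real.mul_self_sqrt (abs_nonneg (u (ψ k) x - u (ψ (k + 1)) x)),
      Real.sqrt_nonneg |u (ψ k) x - u (ψ (k + 1)) x|]
  exact cauchySeq_tendsto_of_complete (cauchySeq_of_summable_dist hx2)

/-- The direct method for convex functionals that are coercive in `L¹`. Lower semicontinuity along
almost everywhere convergent sequences suffices; no compactness is needed. -/
theorem exists_forall_le_of_midpointConvex_of_coercive {X : Type*} [MeasurableSpace X]
    {μ : Measure X} [IsFiniteMeasure μ] {𝒞 𝒟 : Set (X → ℝ)} {T : (X → ℝ) → ℝ} {c C : ℝ}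
    (hc : 0 < c) (hne : 𝒞.Nonempty) (hint : ∀ u ∈ 𝒞, Integrable u μ)
    (hconv : ∀ u ∈ 𝒞, ∀ v ∈ 𝒞, (fun x => (u x + v x) / 2) ∈ 𝒞 ∧
      T (fun x => (u x + v x) / 2) ≤ (T u + T v) / 2)
    (hcoer : ∀ u ∈ 𝒞, c * ∫ x, |u x| ∂μ ≤ T u + C)
    (hlsc : ∀ (f : ℕ → X → ℝ) (M : ℝ), (∀ k, f k ∈ 𝒞) →
      (∀ᵐ x ∂μ, ∃ y, Filter.Tendsto (fun k => f k x) Filter.atTop (nhds y)) →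
      Filter.Tendsto (fun k => T (f k)) Filter.atTop (nhds M) → ∃ u ∈ 𝒟, T u ≤ M) :
    ∃ u ∈ 𝒟, ∀ v ∈ 𝒞, T u ≤ T v := by
  have hbdd : BddBelow (T '' 𝒞) := by
    refine ⟨-C, ?_⟩
    rintro _ ⟨u, hu, rfl⟩
    have h1 := hcoer u hu
    have h2 : 0 ≤ c * ∫ x, |u x| ∂μ := mul_nonneg hc.le (integral_nonneg fun x => abs_nonneg _)
    linarith
  set m := sInf (T '' 𝒞) with hm
  have hmle : ∀ v ∈ 𝒞, m ≤ T v := fun v hv => csInf_le hbdd ⟨v, hv, rfl⟩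
  -- `T` need not be strictly convex, so a minimising sequence alone may fail to converge. The
  -- strictly convex `J` is minimised, approximately, inside the shrinking sublevel sets `S k`.
  set J : (X → ℝ) → ℝ := fun u => ∫ x, √(1 + u x ^ 2) ∂μ with hJ
  have hJ0 : ∀ u, 0 ≤ J u := fun u => integral_nonneg fun x => Real.sqrt_nonneg _
  set S : ℕ → Set (X → ℝ) := fun k => {u ∈ 𝒞 | T u ≤ m + 1 / ((k : ℝ) + 1)} with hS
  have hSne : ∀ k, (S k).Nonempty := by
    intro k
    obtain ⟨_, ⟨u, hu, rfl⟩, hlt⟩ := exists_lt_of_csInf_lt (hne.image T)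
      (show sInf (T '' 𝒞) < m + 1 / ((k : ℝ) + 1) by
        have : (0 : ℝ) < 1 / ((k : ℝ) + 1) := by positivity
        linarith)
    exact ⟨u, hu, hlt.le⟩
  have hSanti : Antitone S := by
    intro k l hkl u hu
    refine ⟨hu.1, hu.2.trans ?_⟩
    have := one_div_le_one_div_of_le (by positivity : (0 : ℝ) < (k : ℝ) + 1)
      (by have : (k : ℝ) ≤ l := by exact_mod_cast hkl
          linarith : (k : ℝ) + 1 ≤ l + 1)
    linarith
  have hSmid : ∀ k, ∀ u ∈ S k, ∀ v ∈ S k, (fun x => (u x + v x) / 2) ∈ S k := by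
    intro k u hu v hv
    obtain ⟨h1, h2⟩ := hconv u hu.1 v hv.1
    exact ⟨h1, by linarith [hu.2, hv.2]⟩
  have hJbd : ∀ k, BddBelow (J '' S k) := fun k => ⟨0, by rintro _ ⟨u, _, rfl⟩; exact hJ0 u⟩
  set j : ℕ → ℝ := fun k => sInf (J '' S k) with hj
  have hjle : ∀ k, ∀ u ∈ S k, j k ≤ J u := fun k u hu => csInf_le (hJbd k) ⟨u, hu, rfl⟩
  have hjmono : Monotone j := fun k l hkl =>
    csInf_le_csInf (hJbd k) ((hSne l).image J) (image_mono (hSanti hkl))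
  set R : ℝ := μ.real univ + (m + 1 + C) / c with hR
  have hJle : ∀ k, ∀ u ∈ S k, J u ≤ R := by
    intro k u hu
    have hi := hint u hu.1
    have h1 : J u ≤ ∫ x, (1 + |u x|) ∂μ :=
      integral_mono (integrable_sqrt_one_add_sq hi) ((integrable_const _).add hi.abs)
        fun x => sqrt_one_add_sq_le _
    have h2 : ∫ x, (1 + |u x|) ∂μ = μ.real univ + ∫ x, |u x| ∂μ := by
      rw [integral_add (integrable_const _) hi.abs]; simp
    have h3 : 1 / ((k : ℝ) + 1) ≤ 1 := by
      rw [div_le_one (by positivity)]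
      have : (0 : ℝ) ≤ k := by positivity
      linarith
    have h4 : ∫ x, |u x| ∂μ ≤ (m + 1 + C) / c := by
      rw [le_div_iff₀ hc, mul_comm]
      linarith [hcoer u hu.1, hu.2]
    linarith
  have hjR : ∀ k, j k ≤ R := fun k => by
    obtain ⟨u, hu⟩ := hSne k
    exact (hjle k u hu).trans (hJle k u hu)
  have hjlim := tendsto_atTop_ciSup hjmono ⟨R, by rintro _ ⟨k, rfl⟩; exact hjR k⟩
  set j' := ⨆ k, j k with hj'
  have hjj' : ∀ k, j k ≤ j' := fun k => hjmono.ge_of_tendsto hjlim k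
  have hex : ∀ k, ∃ u ∈ S k, J u ≤ j k + 1 / ((k : ℝ) + 1) := by
    intro k
    obtain ⟨_, ⟨u, hu, rfl⟩, hlt⟩ := exists_lt_of_csInf_lt ((hSne k).image J)
      (show sInf (J '' S k) < j k + 1 / ((k : ℝ) + 1) by
        have : (0 : ℝ) < 1 / ((k : ℝ) + 1) := by positivity
        linarith)
    exact ⟨u, hu, hlt.le⟩
  choose u huS huJ using hex
  have hui : ∀ k, Integrable (u k) μ := fun k => hint _ (huS k).1
  -- For k ≤ l the midpoint of `u k` and `u l` lies in `S k`, so its `J` is at least j k, while J (u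
  -- k) ≤ j k + 1/(k + 1) and J (u l) ≤ j' + 1/(l + 1). This bounds the convexity gap by ε k, which
  -- tends to 0 because j increases to j'.
  set ε : ℕ → ℝ := fun k => (j' - j k) / 2 + 1 / ((k : ℝ) + 1) with hε
  have hεlim : Filter.Tendsto ε Filter.atTop (nhds 0) := by
    have h1 := ((tendsto_const_nhds (x := j')).sub hjlim).div_const 2
    have h2 := h1.add tendsto_one_div_add_atTop_nhds_zero_nat
    simpa only [hε, sub_self, zero_div, add_zero] using h2
  have hgap : ∀ k l, k ≤ l → (J (u k) + J (u l)) / 2 - J (fun x => (u k x + u l x) / 2) ≤ ε k := by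
    intro k l hkl
    have h1 := hjle k _ (hSmid k _ (huS k) _ (hSanti hkl (huS l)))
    have h2 := huJ k
    have h3 := huJ l
    have h4 := hjj' l
    have h5 := one_div_le_one_div_of_le (by positivity : (0 : ℝ) < (k : ℝ) + 1)
      (by have : (k : ℝ) ≤ l := by exact_mod_cast hkl
          linarith : (k : ℝ) + 1 ≤ l + 1)
    simp only [hε]
    linarith
  have hdist : ∀ l : ℝ, 0 < l → ∀ k k', k ≤ k' →
      ∫ x, √|u k x - u k' x| ∂μ ≤ l * (2 * R) + (l ^ 3)⁻¹ * ε k := by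
    intro l hl k k' hkk
    have i1 := integrable_sqrt_one_add_sq (hui k)
    have i2 := integrable_sqrt_one_add_sq (hui k')
    have i3 : Integrable (fun x => √(1 + ((u k x + u k' x) / 2) ^ 2)) μ :=
      integrable_sqrt_one_add_sq (((hui k).add (hui k')).div_const 2)
    have i4 : Integrable (fun x => √(1 + u k x ^ 2) + √(1 + u k' x ^ 2)) μ := i1.add i2
    have i5 : Integrable (fun x => (√(1 + u k x ^ 2) + √(1 + u k' x ^ 2)) / 2 -
        √(1 + ((u k x + u k' x) / 2) ^ 2)) μ := (i4.div_const 2).sub i3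
    have h1 : ∫ x, √|u k x - u k' x| ∂μ ≤
        ∫ x, (l * (√(1 + u k x ^ 2) + √(1 + u k' x ^ 2)) + (l ^ 3)⁻¹ *
          ((√(1 + u k x ^ 2) + √(1 + u k' x ^ 2)) / 2 - √(1 + ((u k x + u k' x) / 2) ^ 2))) ∂μ := by
      refine integral_mono (integrable_sqrt_abs ((hui k).sub (hui k'))) ?_
        fun x => sqrt_abs_sub_le_convexity_gap _ _ hl
      exact (i4.const_mul l).add (i5.const_mul _)
    refine h1.trans ?_
    rw [integral_add (i4.const_mul l) (i5.const_mul _), integral_const_mul, integral_const_mul,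
      integral_sub (i4.div_const 2) i3, integral_div, integral_add i1 i2]
    have h2 := hgap k k' hkk
    have h3 := hJle k _ (huS k)
    have h4 := hJle k' _ (huS k')
    have h5 : 0 ≤ (l ^ 3)⁻¹ := by positivity
    simp only [hJ] at h2 h3 h4
    gcongr
    linarith
  have hR0 : 0 ≤ R := (hJ0 (u 0)).trans (hJle 0 _ (huS 0))
  obtain ⟨ψ, hψ, hae⟩ := exists_subseq_ae_tendsto_of_integral_sqrt (μ := μ) hui (by
    intro δ hδ
    -- First l makes l · 2R ≤ δ/2; then k₀, depending on l, makes the gap term small.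
    set l := δ / (4 * R + 4) with hl
    have hl0 : 0 < l := by positivity
    obtain ⟨k₀, hk₀⟩ := Filter.eventually_atTop.1
      (hεlim.eventually_le_const (u := l ^ 3 * (δ / 2)) (by positivity))
    refine ⟨k₀, fun k hk k' hkk => (hdist l hl0 k k' hkk).trans ?_⟩
    have h1 : (l ^ 3)⁻¹ * ε k ≤ δ / 2 := by
      rw [inv_mul_le_iff₀ (by positivity)]; exact hk₀ k hk
    have h2 : l * (2 * R) ≤ δ / 2 := by
      rw [hl, div_mul_eq_mul_div, div_le_div_iff₀ (by positivity) (by norm_num)]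
      nlinarith
    linarith)
  have hTlim : Filter.Tendsto (fun k => T (u k)) Filter.atTop (nhds m) := by
    have h1 : Filter.Tendsto (fun k : ℕ => m + 1 / ((k : ℝ) + 1)) Filter.atTop (nhds m) := by
      simpa only [add_zero] using
        (tendsto_const_nhds (x := m)).add (tendsto_one_div_add_atTop_nhds_zero_nat (𝕜 := ℝ))
    refine tendsto_of_tendsto_of_tendsto_of_le_of_le tendsto_const_nhds h1 (fun k => hmle _ (huS k).1)
      (fun k => (huS k).2)
  obtain ⟨w, hw, hwm⟩ := hlsc (fun k => u (ψ k)) m (fun k => (huS _).1) hae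
    (hTlim.comp hψ.tendsto_atTop)
  exact ⟨w, hw, fun v hv => hwm.trans (hmle v hv)⟩

/-! ### Integrability of energy differences over Q(Ω). -/

lemma aemeasurable_abs_sub_div {n : ℕ} (q : ℝ) {u : EuclideanSpace ℝ (Fin n) → ℝ}
    (hu : AEMeasurable u volume) :
    AEMeasurable (fun z : EuclideanSpace ℝ (Fin n) × EuclideanSpace ℝ (Fin n) =>
      |u z.1 - u z.2| / ‖z.1 - z.2‖ ^ q) volume := by
  have h1 : AEMeasurable (fun z : EuclideanSpace ℝ (Fin n) × EuclideanSpace ℝ (Fin n) => u z.1)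
      volume := hu.comp_quasiMeasurePreserving Measure.quasiMeasurePreserving_fst
  have h2 : AEMeasurable (fun z : EuclideanSpace ℝ (Fin n) × EuclideanSpace ℝ (Fin n) => u z.2)
      volume := hu.comp_quasiMeasurePreserving Measure.quasiMeasurePreserving_snd
  have h3 : Measurable (fun z : EuclideanSpace ℝ (Fin n) × EuclideanSpace ℝ (Fin n) =>
      ‖z.1 - z.2‖ ^ q) := by fun_prop
  have h4 := (h1.sub h2).norm
  exact h4.div h3.aemeasurable

lemma volume_restrict_prod {n : ℕ} (A B : Set (EuclideanSpace ℝ (Fin n))) :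
    (volume : Measure (EuclideanSpace ℝ (Fin n) × EuclideanSpace ℝ (Fin n))).restrict (A ×ˢ B) =
      (volume.restrict A).prod (volume.restrict B) := by
  rw [Measure.volume_eq_prod, Measure.prod_restrict]

lemma gagliardoSeminorm_eq_setLIntegral_prod {n : ℕ} (s : ℝ)
    (Ω : Set (EuclideanSpace ℝ (Fin n))) {u : EuclideanSpace ℝ (Fin n) → ℝ}
    (hu : AEMeasurable u volume) :
    gagliardoSeminorm s Ω u = ∫⁻ z in Ω ×ˢ Ω,
      ENNReal.ofReal (|u z.1 - u z.2| / ‖z.1 - z.2‖ ^ ((n : ℝ) + s)) := by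
  rw [volume_restrict_prod, lintegral_prod]
  · rfl
  · rw [← volume_restrict_prod]
    exact (aemeasurable_abs_sub_div _ hu).restrict.ennreal_ofReal

lemma integrableOn_prod_iff_gagliardoSeminorm_lt_top {n : ℕ} (s : ℝ)
    (Ω : Set (EuclideanSpace ℝ (Fin n))) {u : EuclideanSpace ℝ (Fin n) → ℝ}
    (hu : AEMeasurable u volume) :
    IntegrableOn (fun z => |u z.1 - u z.2| / ‖z.1 - z.2‖ ^ ((n : ℝ) + s)) (Ω ×ˢ Ω) volume ↔
      gagliardoSeminorm s Ω u < ∞ := by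
  rw [gagliardoSeminorm_eq_setLIntegral_prod s Ω hu, IntegrableOn, Integrable,
    hasFiniteIntegral_iff_ofReal (Filter.Eventually.of_forall fun z => by positivity)]
  exact and_iff_right (aemeasurable_abs_sub_div _ hu).restrict.aestronglyMeasurable

lemma linearCombination_mem_sobolevSpaceW {n : ℕ} {s : ℝ} {Ω : Set (EuclideanSpace ℝ (Fin n))}
    {u v : EuclideanSpace ℝ (Fin n) → ℝ} (hu : u ∈ sobolevSpaceW s Ω) (hv : v ∈ sobolevSpaceW s Ω)
    (a b : ℝ) : (fun x => a * u x + b * v x) ∈ sobolevSpaceW s Ω := by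
  have hm : AEMeasurable (fun x => a * u x + b * v x) volume :=
    (hu.1.const_mul a).add (hv.1.const_mul b)
  refine ⟨hm, (hu.2.1.const_mul a).add (hv.2.1.const_mul b), ?_⟩
  rw [← integrableOn_prod_iff_gagliardoSeminorm_lt_top s Ω hm]
  have iu := (integrableOn_prod_iff_gagliardoSeminorm_lt_top s Ω hu.1).2 hu.2.2
  have iv := (integrableOn_prod_iff_gagliardoSeminorm_lt_top s Ω hv.1).2 hv.2.2
  refine ((iu.const_mul |a|).add (iv.const_mul |b|)).mono'
    (aemeasurable_abs_sub_div _ hm).restrict.aestronglyMeasurable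
    (Filter.Eventually.of_forall fun z => ?_)
  rw [Real.norm_of_nonneg (by positivity)]
  change _ ≤ |a| * (|u z.1 - u z.2| / ‖z.1 - z.2‖ ^ ((n : ℝ) + s)) +
    |b| * (|v z.1 - v z.2| / ‖z.1 - z.2‖ ^ ((n : ℝ) + s))
  rw [mul_div_assoc', mul_div_assoc', ← add_div, ← abs_mul, ← abs_mul]
  gcongr
  refine le_trans (le_of_eq ?_) (abs_add_le _ _)
  congr 1; ring

/-- By Tonelli, integrating first in y produces the potential. -/
lemma integrableOn_abs_div_of_lintegral_lt_top {n : ℕ} {s : ℝ}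
    {Ω : Set (EuclideanSpace ℝ (Fin n))} {w : EuclideanSpace ℝ (Fin n) → ℝ}
    (hw : AEMeasurable w volume)
    (hfin : ∫⁻ x in Ω, ENNReal.ofReal |w x| * kernelPotential s Ωᶜ x < ∞) :
    IntegrableOn (fun z => |w z.1| / ‖z.1 - z.2‖ ^ ((n : ℝ) + s)) (Ω ×ˢ Ωᶜ) volume := by
  have h1 : AEMeasurable (fun z : EuclideanSpace ℝ (Fin n) × EuclideanSpace ℝ (Fin n) => w z.1)
      volume := hw.comp_quasiMeasurePreserving Measure.quasiMeasurePreserving_fst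
  have h3 : Measurable (fun z : EuclideanSpace ℝ (Fin n) × EuclideanSpace ℝ (Fin n) =>
      ‖z.1 - z.2‖ ^ ((n : ℝ) + s)) := by fun_prop
  have hm : AEMeasurable (fun z : EuclideanSpace ℝ (Fin n) × EuclideanSpace ℝ (Fin n) =>
      |w z.1| / ‖z.1 - z.2‖ ^ ((n : ℝ) + s)) volume := h1.norm.div h3.aemeasurable
  refine ⟨hm.restrict.aestronglyMeasurable, ?_⟩
  rw [hasFiniteIntegral_iff_ofReal (Filter.Eventually.of_forall fun z => by positivity),
    volume_restrict_prod, lintegral_prod _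
      (by rw [← volume_restrict_prod]; exact hm.restrict.ennreal_ofReal)]
  refine lt_of_eq_of_lt (lintegral_congr fun x => ?_) hfin
  unfold kernelPotential
  rw [← lintegral_const_mul _ (by fun_prop)]
  refine lintegral_congr fun y => ?_
  rw [← ENNReal.ofReal_mul (abs_nonneg _), div_eq_mul_inv]
  rfl

lemma energyDifference_swap {n : ℕ} (s : ℝ) (u v : EuclideanSpace ℝ (Fin n) → ℝ)
    (z : EuclideanSpace ℝ (Fin n) × EuclideanSpace ℝ (Fin n)) :
    energyDifference s u v z.swap = energyDifference s u v z := by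
  unfold energyDifference
  rw [Prod.fst_swap, Prod.snd_swap, abs_sub_comm (u z.2), abs_sub_comm (v z.2), norm_sub_rev z.2]

lemma interactionSet_eq {n : ℕ} (Ω : Set (EuclideanSpace ℝ (Fin n))) :
    interactionSet Ω = Ω ×ˢ Ω ∪ (Ω ×ˢ Ωᶜ ∪ Ωᶜ ×ˢ Ω) := by
  ext ⟨x, y⟩
  simp only [interactionSet, mem_compl_iff, mem_prod, mem_union]
  tauto

lemma aemeasurable_energyDifference {n : ℕ} (s : ℝ) {u v : EuclideanSpace ℝ (Fin n) → ℝ}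
    (hu : AEMeasurable u volume) (hv : AEMeasurable v volume) :
    AEMeasurable (energyDifference s u v) volume := by
  refine ((aemeasurable_abs_sub_div ((n : ℝ) + s) hu).sub
    (aemeasurable_abs_sub_div ((n : ℝ) + s) hv)).congr (Filter.Eventually.of_forall fun z => ?_)
  simp only [energyDifference, Pi.sub_apply, sub_div]

lemma integrableOn_energyDifference_prod_self {n : ℕ} {s : ℝ} {Ω : Set (EuclideanSpace ℝ (Fin n))}
    {u v : EuclideanSpace ℝ (Fin n) → ℝ} (hu : u ∈ sobolevSpaceW s Ω) (hv : v ∈ sobolevSpaceW s Ω) :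
    IntegrableOn (energyDifference s u v) (Ω ×ˢ Ω) volume := by
  have iu := (integrableOn_prod_iff_gagliardoSeminorm_lt_top s Ω hu.1).2 hu.2.2
  have iv := (integrableOn_prod_iff_gagliardoSeminorm_lt_top s Ω hv.1).2 hv.2.2
  refine (iu.sub iv).congr (Filter.Eventually.of_forall fun z => ?_)
  simp only [energyDifference, Pi.sub_apply, sub_div]

lemma ae_restrict_prod_compl {n : ℕ} {Ω : Set (EuclideanSpace ℝ (Fin n))} (hΩ : MeasurableSet Ω)
    {P : EuclideanSpace ℝ (Fin n) → Prop} (h : ∀ᵐ x ∂volume, x ∈ Ωᶜ → P x)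
    (A : Set (EuclideanSpace ℝ (Fin n))) :
    ∀ᵐ z ∂volume.restrict (A ×ˢ Ωᶜ), P z.2 := by
  rw [volume_restrict_prod]
  exact Measure.quasiMeasurePreserving_snd.ae ((ae_restrict_iff' hΩ.compl).2 h)

/-- Since u = v outside Ω, the numerator is at most |u(x) - v(x)| by the reverse triangle
inequality, and the Hardy inequality applies to u - v. The common exterior values need no
integrability. -/
lemma integrableOn_energyDifference_prod_compl {n : ℕ} {s : ℝ}
    {Ω : Set (EuclideanSpace ℝ (Fin n))} (hΩ : MeasurableSet Ω)
    (hH : ∀ w ∈ sobolevSpaceW s Ω,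
      ∫⁻ x in Ω, ENNReal.ofReal |w x| * kernelPotential s Ωᶜ x < ∞)
    {u v : EuclideanSpace ℝ (Fin n) → ℝ} (hu : u ∈ sobolevSpaceW s Ω) (hv : v ∈ sobolevSpaceW s Ω)
    (huv : ∀ᵐ x ∂volume, x ∈ Ωᶜ → u x = v x) :
    IntegrableOn (energyDifference s u v) (Ω ×ˢ Ωᶜ) volume := by
  have hw := linearCombination_mem_sobolevSpaceW hu hv 1 (-1)
  refine (integrableOn_abs_div_of_lintegral_lt_top hw.1 (hH _ hw)).mono'
    (aemeasurable_energyDifference s hu.1 hv.1).restrict.aestronglyMeasurable ?_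
  filter_upwards [ae_restrict_prod_compl hΩ huv Ω] with z hz
  unfold energyDifference
  rw [norm_div, Real.norm_eq_abs, Real.norm_of_nonneg (by positivity : 0 ≤ ‖z.1 - z.2‖ ^ ((n : ℝ) + s)), hz]
  refine div_le_div_of_nonneg_right
    ((abs_abs_sub_abs_le (u z.1 - v z.2) (v z.1 - v z.2)).trans (le_of_eq ?_)) (by positivity)
  congr 1; ring

lemma integrableOn_energyDifference_compl_prod {n : ℕ} {s : ℝ}
    {Ω : Set (EuclideanSpace ℝ (Fin n))} {u v : EuclideanSpace ℝ (Fin n) → ℝ}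
    (h : IntegrableOn (energyDifference s u v) (Ω ×ˢ Ωᶜ) volume) :
    IntegrableOn (energyDifference s u v) (Ωᶜ ×ˢ Ω) volume := by
  rw [IntegrableOn, volume_restrict_prod] at h ⊢
  refine h.swap.congr (Filter.Eventually.of_forall fun z => ?_)
  exact energyDifference_swap s u v z

lemma setIntegral_energyDifference_compl_prod {n : ℕ} {s : ℝ}
    (Ω : Set (EuclideanSpace ℝ (Fin n))) (u v : EuclideanSpace ℝ (Fin n) → ℝ) :
    ∫ z in Ωᶜ ×ˢ Ω, energyDifference s u v z = ∫ z in Ω ×ˢ Ωᶜ, energyDifference s u v z := by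
  rw [volume_restrict_prod, volume_restrict_prod, ← integral_prod_swap]
  simp only [energyDifference_swap]

theorem integrableOn_energyDifference_interactionSet {n : ℕ} {s : ℝ}
    {Ω : Set (EuclideanSpace ℝ (Fin n))} (hΩ : MeasurableSet Ω)
    (hH : ∀ w ∈ sobolevSpaceW s Ω,
      ∫⁻ x in Ω, ENNReal.ofReal |w x| * kernelPotential s Ωᶜ x < ∞)
    {u v : EuclideanSpace ℝ (Fin n) → ℝ} (hu : u ∈ sobolevSpaceW s Ω) (hv : v ∈ sobolevSpaceW s Ω)
    (huv : ∀ᵐ x ∂volume, x ∈ Ωᶜ → u x = v x) :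
    IntegrableOn (energyDifference s u v) (interactionSet Ω) volume := by
  have h := integrableOn_energyDifference_prod_compl hΩ hH hu hv huv
  rw [interactionSet_eq]
  exact (integrableOn_energyDifference_prod_self hu hv).union
    (h.union (integrableOn_energyDifference_compl_prod h))

theorem setIntegral_energyDifference_interactionSet {n : ℕ} {s : ℝ}
    {Ω : Set (EuclideanSpace ℝ (Fin n))} (hΩ : MeasurableSet Ω)
    (hH : ∀ w ∈ sobolevSpaceW s Ω,
      ∫⁻ x in Ω, ENNReal.ofReal |w x| * kernelPotential s Ωᶜ x < ∞)
    {u v : EuclideanSpace ℝ (Fin n) → ℝ} (hu : u ∈ sobolevSpaceW s Ω) (hv : v ∈ sobolevSpaceW s Ω)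
    (huv : ∀ᵐ x ∂volume, x ∈ Ωᶜ → u x = v x) :
    ∫ z in interactionSet Ω, energyDifference s u v z =
      (∫ z in Ω ×ˢ Ω, energyDifference s u v z) +
        2 * ∫ z in Ω ×ˢ Ωᶜ, energyDifference s u v z := by
  have h := integrableOn_energyDifference_prod_compl hΩ hH hu hv huv
  have h' := integrableOn_energyDifference_compl_prod h
  have d1 : Disjoint (Ω ×ˢ Ω) (Ω ×ˢ Ωᶜ ∪ Ωᶜ ×ˢ Ω) := by
    refine Set.disjoint_left.2 ?_
    rintro ⟨x, y⟩ ⟨h1, h2⟩ (⟨_, h3⟩ | ⟨h3, _⟩)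
    · exact h3 h2
    · exact h3 h1
  have d2 : Disjoint (Ω ×ˢ Ωᶜ) (Ωᶜ ×ˢ Ω) := by
    refine Set.disjoint_left.2 ?_
    rintro ⟨x, y⟩ ⟨h1, h2⟩ ⟨h3, _⟩
    exact h3 h1
  rw [interactionSet_eq, setIntegral_union d1 ((hΩ.prod hΩ.compl).union (hΩ.compl.prod hΩ))
    (integrableOn_energyDifference_prod_self hu hv) (h.union h'),
    setIntegral_union d2 (hΩ.compl.prod hΩ) h h', setIntegral_energyDifference_compl_prod]
  ring

/-! ### The tail energy and its coercivity. -/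

/-- The renormalised interaction `∫_{ℝⁿ \ Ω} (|t - φ(y)| - |φ(y)|) / |x - y|^{n+s} dy` of the value
`t` at `x` with the exterior datum `φ`. -/
def tailEnergy {n : ℕ} (s : ℝ) (Ω : Set (EuclideanSpace ℝ (Fin n)))
    (φ : EuclideanSpace ℝ (Fin n) → ℝ) (x : EuclideanSpace ℝ (Fin n)) (t : ℝ) : ℝ :=
  ∫ y in Ωᶜ, (|t - φ y| - |φ y|) / ‖x - y‖ ^ ((n : ℝ) + s)

/-- The local tail `∫_{O \ Ω} |φ(y)| / |x - y|^{n+s} dy`. -/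
def localTail {n : ℕ} (s : ℝ) (Ω O : Set (EuclideanSpace ℝ (Fin n)))
    (φ : EuclideanSpace ℝ (Fin n) → ℝ) (x : EuclideanSpace ℝ (Fin n)) : ℝ≥0∞ :=
  ∫⁻ y in O \ Ω, ENNReal.ofReal (|φ y| / ‖x - y‖ ^ ((n : ℝ) + s))

lemma kernelPotential_compl_lt_top {n : ℕ} {s : ℝ} (hs : 0 < s)
    {Ω : Set (EuclideanSpace ℝ (Fin n))} (hΩ : IsOpen Ω) {x : EuclideanSpace ℝ (Fin n)}
    (hx : x ∈ Ω) : kernelPotential s Ωᶜ x < ∞ := by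
  obtain ⟨δ, hδ, hball⟩ := Metric.isOpen_iff.1 hΩ x hx
  refine (kernelPotential_le_kernelTail s fun y hy => ?_).trans_lt (kernelTail_lt_top n hs hδ)
  by_contra hlt
  refine hy (hball ?_)
  rw [Metric.mem_ball, dist_comm, dist_eq_norm]
  exact not_le.1 hlt

lemma integrableOn_rieszKernel_sub {n : ℕ} {s : ℝ} {A : Set (EuclideanSpace ℝ (Fin n))}
    {x : EuclideanSpace ℝ (Fin n)} (h : kernelPotential s A x < ∞) :
    IntegrableOn (fun y => rieszKernel s (x - y)) A volume := by
  refine ⟨Measurable.aestronglyMeasurable (by fun_prop), ?_⟩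
  rw [hasFiniteIntegral_iff_ofReal (Filter.Eventually.of_forall fun y => rieszKernel_nonneg _ _)]
  exact h

lemma setIntegral_rieszKernel_sub {n : ℕ} (s : ℝ) (A : Set (EuclideanSpace ℝ (Fin n)))
    (x : EuclideanSpace ℝ (Fin n)) :
    ∫ y in A, rieszKernel s (x - y) = (kernelPotential s A x).toReal := by
  rw [integral_eq_lintegral_of_nonneg_ae
    (Filter.Eventually.of_forall fun y => rieszKernel_nonneg _ _)
    (Measurable.aestronglyMeasurable (by fun_prop))]
  rfl

lemma abs_sub_abs_div_le {n : ℕ} (s : ℝ) (x y : EuclideanSpace ℝ (Fin n)) (t t' a : ℝ) :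
    |(|t - a| - |a|) / ‖x - y‖ ^ ((n : ℝ) + s) - (|t' - a| - |a|) / ‖x - y‖ ^ ((n : ℝ) + s)| ≤
      |t - t'| * rieszKernel s (x - y) := by
  rw [← sub_div, sub_sub_sub_cancel_right, abs_div,
    abs_of_nonneg (by positivity : 0 ≤ ‖x - y‖ ^ ((n : ℝ) + s)), div_eq_mul_inv]
  refine mul_le_mul_of_nonneg_right ?_ (rieszKernel_nonneg s (x - y))
  refine (abs_abs_sub_abs_le (t - a) (t' - a)).trans (le_of_eq ?_)
  congr 1; ring

lemma integrableOn_tailEnergy {n : ℕ} {s : ℝ} {Ω A : Set (EuclideanSpace ℝ (Fin n))}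
    {φ : EuclideanSpace ℝ (Fin n) → ℝ} (hφ : AEMeasurable φ (volume.restrict Ωᶜ))
    (hA : A ⊆ Ωᶜ) {x : EuclideanSpace ℝ (Fin n)} (hx : kernelPotential s Ωᶜ x < ∞) (t : ℝ) :
    IntegrableOn (fun y => (|t - φ y| - |φ y|) / ‖x - y‖ ^ ((n : ℝ) + s)) A volume := by
  refine IntegrableOn.mono_set ?_ hA
  have hm : Measurable fun y : EuclideanSpace ℝ (Fin n) => ‖x - y‖ ^ ((n : ℝ) + s) := by fun_prop
  refine ((integrableOn_rieszKernel_sub hx).const_mul |t|).mono'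
    (((hφ.const_sub t).norm.sub hφ.norm).div hm.aemeasurable).aestronglyMeasurable
    (Filter.Eventually.of_forall fun y => ?_)
  simpa only [Real.norm_eq_abs, zero_sub, abs_neg, sub_self, zero_div, sub_zero] using
    abs_sub_abs_div_le s x y t 0 (φ y)

/-- The potential of the complement at x is a Lipschitz constant in t. Continuity lets the tail
energy follow almost everywhere limits. -/
lemma continuous_tailEnergy {n : ℕ} {s : ℝ} {Ω : Set (EuclideanSpace ℝ (Fin n))}
    {φ : EuclideanSpace ℝ (Fin n) → ℝ} (hφ : AEMeasurable φ (volume.restrict Ωᶜ))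
    {x : EuclideanSpace ℝ (Fin n)} (hx : kernelPotential s Ωᶜ x < ∞) :
    Continuous (tailEnergy s Ω φ x) := by
  refine (LipschitzWith.of_dist_le_mul (K := (kernelPotential s Ωᶜ x).toNNReal)
    fun t t' => ?_).continuous
  rw [Real.dist_eq, Real.dist_eq, tailEnergy, tailEnergy,
    ← integral_sub (integrableOn_tailEnergy hφ subset_rfl hx t)
      (integrableOn_tailEnergy hφ subset_rfl hx t')]
  have h : ‖∫ y in Ωᶜ, ((|t - φ y| - |φ y|) / ‖x - y‖ ^ ((n : ℝ) + s) -
      (|t' - φ y| - |φ y|) / ‖x - y‖ ^ ((n : ℝ) + s))‖ ≤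
        ∫ y in Ωᶜ, |t - t'| * rieszKernel s (x - y) :=
    norm_integral_le_of_norm_le ((integrableOn_rieszKernel_sub hx).const_mul |t - t'|)
      (Filter.Eventually.of_forall fun y => abs_sub_abs_div_le s x y t t' (φ y))
  rw [integral_const_mul, setIntegral_rieszKernel_sub, mul_comm] at h
  exact h

/-- On `O \ Ω` use |t - a| - |a| ≥ |t| - 2|a|, whose last term is paid by the local tail; on the
complement of `O`, where φ is uncontrolled, use |t - a| - |a| ≥ -|t|. The far region thus counts
twice: it is missing from the gain and it is a loss. -/
lemma le_tailEnergy {n : ℕ} {s : ℝ} {Ω O : Set (EuclideanSpace ℝ (Fin n))}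
    (hO : MeasurableSet O) (hΩO : Ω ⊆ O) {φ : EuclideanSpace ℝ (Fin n) → ℝ}
    (hφ : AEMeasurable φ (volume.restrict Ωᶜ)) {x : EuclideanSpace ℝ (Fin n)}
    (hx : kernelPotential s Ωᶜ x < ∞) (hh : localTail s Ω O φ x < ∞) (t : ℝ) :
    ((kernelPotential s Ωᶜ x).toReal - 2 * (kernelPotential s Oᶜ x).toReal) * |t| ≤
      tailEnergy s Ω φ x t + 2 * (localTail s Ω O φ x).toReal := by
  have hsub1 : O \ Ω ⊆ Ωᶜ := fun y hy => hy.2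
  have hsub2 : Oᶜ ⊆ Ωᶜ := compl_subset_compl.2 hΩO
  have hun : Ωᶜ = (O \ Ω) ∪ Oᶜ := by
    ext y
    have := @hΩO y
    simp only [mem_compl_iff, mem_union, mem_sdiff]
    tauto
  have hd : Disjoint (O \ Ω) Oᶜ := Set.disjoint_left.2 fun y h1 h2 => h2 h1.1
  have i1 := integrableOn_tailEnergy hφ hsub1 hx t
  have i2 := integrableOn_tailEnergy hφ hsub2 hx t
  have ik := integrableOn_rieszKernel_sub hx
  have ik1 := ik.mono_set hsub1
  have ik2 := ik.mono_set hsub2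
  have hφ1 : AEMeasurable φ (volume.restrict (O \ Ω)) :=
    hφ.mono_measure (Measure.restrict_mono hsub1 le_rfl)
  have hm : Measurable fun y : EuclideanSpace ℝ (Fin n) => ‖x - y‖ ^ ((n : ℝ) + s) := by fun_prop
  have hφm : AEMeasurable (fun y => |φ y| / ‖x - y‖ ^ ((n : ℝ) + s)) (volume.restrict (O \ Ω)) :=
    hφ1.norm.div hm.aemeasurable
  have iφ : IntegrableOn (fun y => |φ y| / ‖x - y‖ ^ ((n : ℝ) + s)) (O \ Ω) volume := by
    refine ⟨hφm.aestronglyMeasurable, ?_⟩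
    rw [hasFiniteIntegral_iff_ofReal (Filter.Eventually.of_forall fun y => by positivity)]
    exact hh
  have eφ : ∫ y in O \ Ω, |φ y| / ‖x - y‖ ^ ((n : ℝ) + s) = (localTail s Ω O φ x).toReal := by
    rw [integral_eq_lintegral_of_nonneg_ae (Filter.Eventually.of_forall fun y => by positivity)
      hφm.aestronglyMeasurable]
    rfl
  have e1 : tailEnergy s Ω φ x t =
      (∫ y in O \ Ω, (|t - φ y| - |φ y|) / ‖x - y‖ ^ ((n : ℝ) + s)) +
        ∫ y in Oᶜ, (|t - φ y| - |φ y|) / ‖x - y‖ ^ ((n : ℝ) + s) := by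
    rw [tailEnergy, ← setIntegral_union hd hO.compl i1 i2, ← hun]
  have e2 : (kernelPotential s Ωᶜ x).toReal =
      (kernelPotential s (O \ Ω) x).toReal + (kernelPotential s Oᶜ x).toReal := by
    rw [← setIntegral_rieszKernel_sub, ← setIntegral_rieszKernel_sub,
      ← setIntegral_rieszKernel_sub, ← setIntegral_union hd hO.compl ik1 ik2, ← hun]
  have l1 : |t| * (kernelPotential s (O \ Ω) x).toReal - 2 * (localTail s Ω O φ x).toReal ≤
      ∫ y in O \ Ω, (|t - φ y| - |φ y|) / ‖x - y‖ ^ ((n : ℝ) + s) := by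
    rw [← setIntegral_rieszKernel_sub, ← eφ, ← integral_const_mul, ← integral_const_mul,
      ← integral_sub (ik1.const_mul _) (iφ.const_mul _)]
    refine integral_mono ((ik1.const_mul _).sub (iφ.const_mul _)) i1 fun y => ?_
    change |t| * rieszKernel s (x - y) - 2 * (|φ y| / ‖x - y‖ ^ ((n : ℝ) + s)) ≤ _
    rw [rieszKernel, div_eq_mul_inv, div_eq_mul_inv, ← mul_assoc, ← sub_mul]
    refine mul_le_mul_of_nonneg_right ?_ (by positivity)
    linarith [abs_sub_abs_le_abs_sub t (φ y)]
  have l2 : -(|t| * (kernelPotential s Oᶜ x).toReal) ≤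
      ∫ y in Oᶜ, (|t - φ y| - |φ y|) / ‖x - y‖ ^ ((n : ℝ) + s) := by
    rw [← setIntegral_rieszKernel_sub, ← integral_const_mul, ← integral_neg]
    refine integral_mono (ik2.const_mul _).neg i2 fun y => ?_
    change -(|t| * rieszKernel s (x - y)) ≤ _
    rw [rieszKernel, div_eq_mul_inv, ← neg_mul]
    refine mul_le_mul_of_nonneg_right ?_ (by positivity)
    have := abs_sub_abs_le_abs_sub (φ y) t
    rw [abs_sub_comm] at this
    linarith
  rw [e1, e2]
  linarith

/-- Coercivity of the tail energy when the local tail is taken over a sufficiently large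
neighbourhood of `Ω`. -/
theorem mul_abs_le_tailEnergy {n : ℕ} {s : ℝ} (hs : 0 < s)
    {Ω : Set (EuclideanSpace ℝ (Fin n))} (hΩ : IsOpen Ω) (hb : Bornology.IsBounded Ω)
    (hd : 0 < Metric.diam Ω) {φ : EuclideanSpace ℝ (Fin n) → ℝ}
    (hφ : AEMeasurable φ (volume.restrict Ωᶜ)) {x : EuclideanSpace ℝ (Fin n)} (hx : x ∈ Ω)
    (hh : localTail s Ω (Metric.thickening (2 * 4 ^ (1 / s) * Metric.diam Ω) Ω) φ x < ∞) (t : ℝ) :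
    (kernelTail n s (2 * Metric.diam Ω)).toReal / 2 * |t| ≤ tailEnergy s Ω φ x t +
      2 * (localTail s Ω (Metric.thickening (2 * 4 ^ (1 / s) * Metric.diam Ω) Ω) φ x).toReal := by
  set d := Metric.diam Ω with hdd
  set O := Metric.thickening (2 * 4 ^ (1 / s) * d) Ω with hO
  have hκ := kernelPotential_compl_lt_top hs hΩ hx
  refine le_trans ?_ (le_tailEnergy Metric.isOpen_thickening.measurableSet
    (Metric.self_subset_thickening (by positivity) _) hφ hκ hh t)
  refine mul_le_mul_of_nonneg_right ?_ (abs_nonneg t)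
  -- Points at distance at least 2d > d from x cannot lie in Ω.
  have h1 : (kernelTail n s (2 * d)).toReal ≤ (kernelPotential s Ωᶜ x).toReal := by
    refine ENNReal.toReal_mono hκ.ne (kernelTail_le_kernelPotential s fun y hy hyΩ => ?_)
    have := Metric.dist_le_diam_of_mem hb hx hyΩ
    rw [dist_eq_norm] at this
    linarith
  have h2 : (kernelPotential s Oᶜ x).toReal ≤ (kernelTail n s (2 * 4 ^ (1 / s) * d)).toReal := by
    refine ENNReal.toReal_mono (kernelTail_lt_top n hs (by positivity)).ne
      (kernelPotential_le_kernelTail s fun y hy => ?_)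
    by_contra hlt
    refine hy (Metric.mem_thickening_iff.2 ⟨x, hx, ?_⟩)
    rw [dist_comm, dist_eq_norm]
    exact not_le.1 hlt
  -- Enlarging the radius by 4^(1/s) divides the tail by exactly 4, so twice the far mass takes away
  -- only half of the tail at radius 2d.
  have h3 : (kernelTail n s (2 * 4 ^ (1 / s) * d)).toReal = (kernelTail n s (2 * d)).toReal / 4 := by
    have h4 : (4 : ℝ) ^ (1 / s) > 0 := by positivity
    rw [kernelTail_eq n s (by positivity : 0 < 2 * 4 ^ (1 / s) * d),
      kernelTail_eq n s (by positivity : 0 < 2 * d), ENNReal.toReal_mul, ENNReal.toReal_mul,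
      ENNReal.toReal_ofReal (by positivity), ENNReal.toReal_ofReal (by positivity),
      show 2 * 4 ^ (1 / s) * d = 2 * d * 4 ^ (1 / s) by ring,
      Real.mul_rpow (by positivity) (by positivity), ← Real.rpow_mul (by norm_num)]
    rw [show 1 / s * -s = -1 by field_simp, Real.rpow_neg_one]
    ring
  linarith

/-! ### The renormalised energy: decomposition, convexity, coercivity. -/

/-- The energy of `u`, renormalised by the energy of the extension by zero of the datum `φ`. -/
def renormalisedEnergy {n : ℕ} (s : ℝ) (Ω : Set (EuclideanSpace ℝ (Fin n)))
    (φ u : EuclideanSpace ℝ (Fin n) → ℝ) : ℝ :=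
  ∫ z in interactionSet Ω, energyDifference s u (Ωᶜ.indicator φ) z

lemma indicator_compl_mem_sobolevSpaceWWithDatum {n : ℕ} (s : ℝ)
    {Ω : Set (EuclideanSpace ℝ (Fin n))} (hΩ : MeasurableSet Ω)
    {φ : EuclideanSpace ℝ (Fin n) → ℝ} (hφ : AEMeasurable φ (volume.restrict Ωᶜ)) :
    Ωᶜ.indicator φ ∈ sobolevSpaceWWithDatum s Ω φ := by
  have h0 : ∀ x ∈ Ω, Ωᶜ.indicator φ x = 0 := fun x hx =>
    indicator_of_notMem (notMem_compl_iff.2 hx) φ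
  refine ⟨⟨(aemeasurable_indicator_iff hΩ.compl).2 hφ, ?_, ?_⟩, fun y hy => indicator_of_mem hy φ⟩
  · exact integrableOn_zero.congr_fun (fun x hx => (h0 x hx).symm) hΩ
  · have : gagliardoSeminorm s Ω (Ωᶜ.indicator φ) = 0 := by
      unfold gagliardoSeminorm
      refine (setLIntegral_congr_fun hΩ fun x hx => ?_).trans lintegral_zero
      refine (setLIntegral_congr_fun hΩ fun y hy => ?_).trans lintegral_zero
      simp only [h0 x hx, h0 y hy, sub_self, abs_zero, zero_div, ENNReal.ofReal_zero]
    rw [this]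
    exact ENNReal.zero_lt_top

/-- The reference function vanishes in Ω, so Ω × Ω leaves the Gagliardo integral; Fubini on Ω × Ωᶜ
yields the tail energy, doubled by symmetry. -/
lemma integrable_tailEnergy_and_renormalisedEnergy_eq {n : ℕ} {s : ℝ}
    {Ω : Set (EuclideanSpace ℝ (Fin n))} (hΩ : MeasurableSet Ω)
    (hH : ∀ w ∈ sobolevSpaceW s Ω,
      ∫⁻ x in Ω, ENNReal.ofReal |w x| * kernelPotential s Ωᶜ x < ∞)
    {φ : EuclideanSpace ℝ (Fin n) → ℝ} (hφ : AEMeasurable φ (volume.restrict Ωᶜ))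
    {u : EuclideanSpace ℝ (Fin n) → ℝ} (hu : u ∈ sobolevSpaceW s Ω)
    (huφ : ∀ᵐ x ∂volume, x ∈ Ωᶜ → u x = φ x) :
    IntegrableOn (fun x => tailEnergy s Ω φ x (u x)) Ω volume ∧
      renormalisedEnergy s Ω φ u =
        (∫ z in Ω ×ˢ Ω, |u z.1 - u z.2| / ‖z.1 - z.2‖ ^ ((n : ℝ) + s)) +
          2 * ∫ x in Ω, tailEnergy s Ω φ x (u x) := by
  have hv := indicator_compl_mem_sobolevSpaceWWithDatum s hΩ hφ
  set v := Ωᶜ.indicator φ with hvdef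
  have hv0 : ∀ x ∈ Ω, v x = 0 := fun x hx => indicator_of_notMem (notMem_compl_iff.2 hx) φ
  have huv : ∀ᵐ x ∂volume, x ∈ Ωᶜ → u x = v x := by
    filter_upwards [huφ] with x hx hxΩ
    rw [hx hxΩ, hv.2 x hxΩ]
  have hi := integrableOn_energyDifference_prod_compl hΩ hH hu hv.1 huv
  have inner_eq : ∀ x ∈ Ω, ∫ y in Ωᶜ, energyDifference s u v (x, y) =
      tailEnergy s Ω φ x (u x) := by
    intro x hx
    refine integral_congr_ae ?_
    filter_upwards [(ae_restrict_iff' hΩ.compl).2 huφ, ae_restrict_mem hΩ.compl] with y hy hyΩ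
    simp only [energyDifference]
    rw [hv0 x hx, hv.2 y hyΩ, hy, zero_sub, abs_neg]
  constructor
  · have h := hi
    rw [IntegrableOn, volume_restrict_prod] at h
    exact IntegrableOn.congr_fun h.integral_prod_left inner_eq hΩ
  · rw [renormalisedEnergy, setIntegral_energyDifference_interactionSet hΩ hH hu hv.1 huv]
    congr 1
    · refine setIntegral_congr_fun (hΩ.prod hΩ) fun z hz => ?_
      simp only [energyDifference]
      rw [hv0 _ hz.1, hv0 _ hz.2, sub_self, abs_zero, sub_zero]
    · congr 1
      rw [Measure.volume_eq_prod] at hi ⊢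
      rw [setIntegral_prod _ hi]
      exact setIntegral_congr_fun hΩ inner_eq

/-- The integrand is convex in u pointwise; the Hardy inequality makes all three energies genuine
integrals, so the inequality can be integrated. -/
lemma renormalisedEnergy_midpoint_le {n : ℕ} {s : ℝ}
    {Ω : Set (EuclideanSpace ℝ (Fin n))} (hΩ : MeasurableSet Ω)
    (hH : ∀ w ∈ sobolevSpaceW s Ω,
      ∫⁻ x in Ω, ENNReal.ofReal |w x| * kernelPotential s Ωᶜ x < ∞)
    {φ : EuclideanSpace ℝ (Fin n) → ℝ} (hφ : AEMeasurable φ (volume.restrict Ωᶜ))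
    {u v : EuclideanSpace ℝ (Fin n) → ℝ} (hu : u ∈ sobolevSpaceW s Ω)
    (huφ : ∀ᵐ x ∂volume, x ∈ Ωᶜ → u x = φ x) (hv : v ∈ sobolevSpaceW s Ω)
    (hvφ : ∀ᵐ x ∂volume, x ∈ Ωᶜ → v x = φ x) :
    ((fun x => (u x + v x) / 2) ∈ sobolevSpaceW s Ω ∧
      ∀ᵐ x ∂volume, x ∈ Ωᶜ → (u x + v x) / 2 = φ x) ∧
    renormalisedEnergy s Ω φ (fun x => (u x + v x) / 2) ≤
      (renormalisedEnergy s Ω φ u + renormalisedEnergy s Ω φ v) / 2 := by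
  have h0 := indicator_compl_mem_sobolevSpaceWWithDatum s hΩ hφ
  have hm : (fun x => (u x + v x) / 2) ∈ sobolevSpaceW s Ω := by
    have := linearCombination_mem_sobolevSpaceW hu hv (1 / 2) (1 / 2)
    convert this using 2
    ring
  have hmφ : ∀ᵐ x ∂volume, x ∈ Ωᶜ → (u x + v x) / 2 = φ x := by
    filter_upwards [huφ, hvφ] with x h1 h2 hx
    rw [h1 hx, h2 hx]; ring
  refine ⟨⟨hm, hmφ⟩, ?_⟩
  have key : ∀ w : EuclideanSpace ℝ (Fin n) → ℝ, w ∈ sobolevSpaceW s Ω →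
      (∀ᵐ x ∂volume, x ∈ Ωᶜ → w x = φ x) →
      IntegrableOn (energyDifference s w (Ωᶜ.indicator φ)) (interactionSet Ω) volume := by
    intro w hw hwφ
    refine integrableOn_energyDifference_interactionSet hΩ hH hw h0.1 ?_
    filter_upwards [hwφ] with x hx hxΩ
    rw [hx hxΩ, h0.2 x hxΩ]
  have iu := key u hu huφ
  have iv := key v hv hvφ
  unfold renormalisedEnergy
  rw [← integral_add iu iv, ← integral_div]
  refine integral_mono (key _ hm hmφ) ((iu.add iv).div_const 2) fun z => ?_
  simp only [energyDifference]
  rw [← add_div, div_right_comm]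
  refine div_le_div_of_nonneg_right ?_ (by positivity)
  have h1 : |(u z.1 + v z.1) / 2 - (u z.2 + v z.2) / 2| ≤
      (|u z.1 - u z.2| + |v z.1 - v z.2|) / 2 := by
    rw [show (u z.1 + v z.1) / 2 - (u z.2 + v z.2) / 2 =
      ((u z.1 - u z.2) + (v z.1 - v z.2)) / 2 by ring, abs_div, abs_two]
    have := abs_add_le (u z.1 - u z.2) (v z.1 - v z.2)
    linarith
  linarith

lemma renormalisedEnergy_coercive {n : ℕ} {s : ℝ}
    {Ω : Set (EuclideanSpace ℝ (Fin n))} (hΩ : MeasurableSet Ω)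
    (hH : ∀ w ∈ sobolevSpaceW s Ω,
      ∫⁻ x in Ω, ENNReal.ofReal |w x| * kernelPotential s Ωᶜ x < ∞)
    {φ : EuclideanSpace ℝ (Fin n) → ℝ} (hφ : AEMeasurable φ (volume.restrict Ωᶜ))
    {c : ℝ} {H : EuclideanSpace ℝ (Fin n) → ℝ} (hHi : IntegrableOn H Ω volume)
    (hlow : ∀ᵐ x ∂volume.restrict Ω, ∀ t, c * |t| ≤ tailEnergy s Ω φ x t + H x)
    {u : EuclideanSpace ℝ (Fin n) → ℝ} (hu : u ∈ sobolevSpaceW s Ω)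
    (huφ : ∀ᵐ x ∂volume, x ∈ Ωᶜ → u x = φ x) :
    2 * c * ∫ x in Ω, |u x| ≤ renormalisedEnergy s Ω φ u + 2 * ∫ x in Ω, H x := by
  obtain ⟨hi, he⟩ := integrable_tailEnergy_and_renormalisedEnergy_eq hΩ hH hφ hu huφ
  have h1 : c * ∫ x in Ω, |u x| ≤ (∫ x in Ω, tailEnergy s Ω φ x (u x)) + ∫ x in Ω, H x := by
    rw [← integral_const_mul, ← integral_add hi hHi]
    refine integral_mono_ae (hu.2.1.abs.const_mul c) (hi.add hHi) ?_
    filter_upwards [hlow] with x hx using hx _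
  have h2 : 0 ≤ ∫ z in Ω ×ˢ Ω, |u z.1 - u z.2| / ‖z.1 - z.2‖ ^ ((n : ℝ) + s) :=
    integral_nonneg fun z => by positivity
  rw [he]
  linarith

/-! ### Lower semicontinuity along almost everywhere limits. -/

lemma liminf_add_liminf_le (a b : ℕ → ℝ≥0∞) :
    Filter.liminf a Filter.atTop + Filter.liminf b Filter.atTop ≤
      Filter.liminf (fun k => a k + b k) Filter.atTop := by
  rw [Filter.liminf_eq_iSup_iInf_of_nat, Filter.liminf_eq_iSup_iInf_of_nat,
    Filter.liminf_eq_iSup_iInf_of_nat, ENNReal.iSup_add_iSup_of_monotone]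
  · exact iSup_mono fun i => le_iInf₂ fun k hk => add_le_add (iInf₂_le k hk) (iInf₂_le k hk)
  · exact fun i j hij => le_iInf₂ fun k hk => iInf₂_le k (le_trans hij hk)
  · exact fun i j hij => le_iInf₂ fun k hk => iInf₂_le k (le_trans hij hk)

lemma lintegral_le_liminf_of_ae_tendsto {X : Type*} [MeasurableSpace X] {μ : Measure X}
    {F : ℕ → X → ℝ≥0∞} {G : X → ℝ≥0∞} (hF : ∀ k, AEMeasurable (F k) μ)
    (h : ∀ᵐ x ∂μ, Filter.Tendsto (fun k => F k x) Filter.atTop (nhds (G x))) :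
    ∫⁻ x, G x ∂μ ≤ Filter.liminf (fun k => ∫⁻ x, F k x ∂μ) Filter.atTop := by
  refine le_trans (le_of_eq (lintegral_congr_ae ?_)) (lintegral_liminf_le' hF)
  filter_upwards [h] with x hx using hx.liminf_eq.symm

lemma setLIntegral_prod_le_liminf_of_ae_tendsto {n : ℕ} (q : ℝ)
    {Ω : Set (EuclideanSpace ℝ (Fin n))} {f : ℕ → EuclideanSpace ℝ (Fin n) → ℝ}
    {u : EuclideanSpace ℝ (Fin n) → ℝ} (hf : ∀ k, AEMeasurable (f k) volume)
    (hconv : ∀ᵐ x ∂volume.restrict Ω,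
      Filter.Tendsto (fun k => f k x) Filter.atTop (nhds (u x))) :
    ∫⁻ z in Ω ×ˢ Ω, ENNReal.ofReal (|u z.1 - u z.2| / ‖z.1 - z.2‖ ^ q) ≤
      Filter.liminf (fun k => ∫⁻ z in Ω ×ˢ Ω,
        ENNReal.ofReal (|f k z.1 - f k z.2| / ‖z.1 - z.2‖ ^ q)) Filter.atTop := by
  refine lintegral_le_liminf_of_ae_tendsto
    (fun k => (aemeasurable_abs_sub_div q (hf k)).restrict.ennreal_ofReal) ?_
  rw [volume_restrict_prod]
  filter_upwards [Measure.quasiMeasurePreserving_fst.ae hconv,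
    Measure.quasiMeasurePreserving_snd.ae hconv] with z h1 h2
  exact ENNReal.tendsto_ofReal ((h1.sub h2).abs.div_const _)

/-- Fatou's lemma for the Gagliardo part and for the tail energy, which adding `H` makes
nonnegative. The limit's membership in 𝒲^s(Ω) is part of the conclusion: it must be known before its
renormalised energy can be decomposed. -/
lemma mem_sobolevSpaceW_and_renormalisedEnergy_le_of_tendsto {n : ℕ} {s : ℝ} (hs : 0 < s)
    {Ω : Set (EuclideanSpace ℝ (Fin n))} (hΩ : IsOpen Ω)
    (hH : ∀ w ∈ sobolevSpaceW s Ω,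
      ∫⁻ x in Ω, ENNReal.ofReal |w x| * kernelPotential s Ωᶜ x < ∞)
    {φ : EuclideanSpace ℝ (Fin n) → ℝ} (hφ : AEMeasurable φ (volume.restrict Ωᶜ))
    {c : ℝ} (hc : 0 < c) {H : EuclideanSpace ℝ (Fin n) → ℝ} (hHi : IntegrableOn H Ω volume)
    (hlow : ∀ᵐ x ∂volume.restrict Ω, ∀ t, c * |t| ≤ tailEnergy s Ω φ x t + H x)
    {f : ℕ → EuclideanSpace ℝ (Fin n) → ℝ} {M : ℝ} (hf : ∀ k, f k ∈ sobolevSpaceW s Ω)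
    (hfφ : ∀ k, ∀ᵐ x ∂volume, x ∈ Ωᶜ → f k x = φ x)
    {u : EuclideanSpace ℝ (Fin n) → ℝ} (hum : AEMeasurable u volume)
    (huφ : ∀ᵐ x ∂volume, x ∈ Ωᶜ → u x = φ x)
    (hconv : ∀ᵐ x ∂volume.restrict Ω,
      Filter.Tendsto (fun k => f k x) Filter.atTop (nhds (u x)))
    (hM : Filter.Tendsto (fun k => renormalisedEnergy s Ω φ (f k)) Filter.atTop (nhds M)) :
    u ∈ sobolevSpaceW s Ω ∧ renormalisedEnergy s Ω φ u ≤ M := by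
  have hΩm := hΩ.measurableSet
  have hg := fun k => integrable_tailEnergy_and_renormalisedEnergy_eq hΩm hH hφ (hf k) (hfφ k)
  have hgag := fun k => (integrableOn_prod_iff_gagliardoSeminorm_lt_top s Ω (hf k).1).2 (hf k).2.2
  set q : ℝ := (n : ℝ) + s
  have hgu : ∀ᵐ x ∂volume.restrict Ω, Filter.Tendsto
      (fun k => tailEnergy s Ω φ x (f k x) + H x) Filter.atTop
        (nhds (tailEnergy s Ω φ x (u x) + H x)) := by
    filter_upwards [hconv, ae_restrict_mem hΩm] with x hx hxΩ
    exact (((continuous_tailEnergy hφ (kernelPotential_compl_lt_top hs hΩ hxΩ)).tendsto _).comp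
      hx).add_const _
  have hA : ∫⁻ z in Ω ×ˢ Ω, ENNReal.ofReal (|u z.1 - u z.2| / ‖z.1 - z.2‖ ^ q) ≤
      Filter.liminf (fun k => ENNReal.ofReal
        (∫ z in Ω ×ˢ Ω, |f k z.1 - f k z.2| / ‖z.1 - z.2‖ ^ q)) Filter.atTop := by
    refine (setLIntegral_prod_le_liminf_of_ae_tendsto q (fun k => (hf k).1) hconv).trans
      (le_of_eq ?_)
    refine congrArg (fun F => Filter.liminf F Filter.atTop) (funext fun k => ?_)
    exact (ofReal_integral_eq_lintegral_ofReal (hgag k)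
      (Filter.Eventually.of_forall fun z => by positivity)).symm
  have hBnn : ∀ w : EuclideanSpace ℝ (Fin n) → ℝ,
      0 ≤ᵐ[volume.restrict Ω] fun x => tailEnergy s Ω φ x (w x) + H x := by
    intro w
    filter_upwards [hlow] with x hx
    exact le_trans (by positivity) (hx (w x))
  have hB : ∫⁻ x in Ω, ENNReal.ofReal (tailEnergy s Ω φ x (u x) + H x) ≤
      Filter.liminf (fun k => ENNReal.ofReal
        (∫ x in Ω, (tailEnergy s Ω φ x (f k x) + H x))) Filter.atTop := by
    refine (lintegral_le_liminf_of_ae_tendsto (F := fun k x =>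
      ENNReal.ofReal (tailEnergy s Ω φ x (f k x) + H x))
      (fun k => ((hg k).1.add hHi).aestronglyMeasurable.aemeasurable.ennreal_ofReal) ?_).trans
      (le_of_eq ?_)
    · filter_upwards [hgu] with x hx
      exact ENNReal.tendsto_ofReal hx
    · refine congrArg (fun F => Filter.liminf F Filter.atTop) (funext fun k => ?_)
      exact (ofReal_integral_eq_lintegral_ofReal ((hg k).1.add hHi) (hBnn _)).symm
  set α : ℕ → ℝ := fun k => ∫ z in Ω ×ˢ Ω, |f k z.1 - f k z.2| / ‖z.1 - z.2‖ ^ q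
  set β : ℕ → ℝ := fun k => ∫ x in Ω, (tailEnergy s Ω φ x (f k x) + H x)
  have hα0 : ∀ k, 0 ≤ α k := fun k => integral_nonneg fun z => by positivity
  have hβ0 : ∀ k, 0 ≤ β k := fun k => integral_nonneg_of_ae (hBnn _)
  have hαβ : ∀ k, α k + 2 * β k = renormalisedEnergy s Ω φ (f k) + 2 * ∫ x in Ω, H x := by
    intro k
    rw [(hg k).2]
    simp only [β]
    rw [integral_add (hg k).1 hHi]
    ring
  have htot : Filter.Tendsto (fun k => α k + 2 * β k) Filter.atTop
      (nhds (M + 2 * ∫ x in Ω, H x)) := by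
    simp only [hαβ]
    exact hM.add_const _
  have hM0 : 0 ≤ M + 2 * ∫ x in Ω, H x :=
    ge_of_tendsto' htot fun k => by have := hα0 k; have := hβ0 k; positivity
  -- The tail term appears twice because of its factor 2 in the energy.
  have hAB : (∫⁻ z in Ω ×ˢ Ω, ENNReal.ofReal (|u z.1 - u z.2| / ‖z.1 - z.2‖ ^ q)) +
      ((∫⁻ x in Ω, ENNReal.ofReal (tailEnergy s Ω φ x (u x) + H x)) +
        ∫⁻ x in Ω, ENNReal.ofReal (tailEnergy s Ω φ x (u x) + H x)) ≤
      ENNReal.ofReal (M + 2 * ∫ x in Ω, H x) := by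
    refine (add_le_add hA (add_le_add hB hB)).trans ?_
    refine (add_le_add_right (liminf_add_liminf_le _ _) _).trans ?_
    refine (liminf_add_liminf_le _ _).trans (le_of_eq ?_)
    refine ((ENNReal.tendsto_ofReal htot).congr fun k => ?_).liminf_eq
    rw [two_mul, ENNReal.ofReal_add (hα0 k) (add_nonneg (hβ0 k) (hβ0 k)),
      ENNReal.ofReal_add (hβ0 k) (hβ0 k)]
  have hA' : ∫⁻ z in Ω ×ˢ Ω, ENNReal.ofReal (|u z.1 - u z.2| / ‖z.1 - z.2‖ ^ q) < ∞ :=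
    lt_of_le_of_lt (le_self_add.trans hAB) ENNReal.ofReal_lt_top
  have hB' : ∫⁻ x in Ω, ENNReal.ofReal (tailEnergy s Ω φ x (u x) + H x) < ∞ :=
    lt_of_le_of_lt ((le_self_add.trans le_add_self).trans hAB) ENNReal.ofReal_lt_top
  have huW : u ∈ sobolevSpaceW s Ω := by
    refine ⟨hum, ⟨hum.restrict.aestronglyMeasurable, ?_⟩, ?_⟩
    · rw [hasFiniteIntegral_iff_norm]
      -- The coercive lower bound turns finite tail energy into integrability of u.
      have h1 : ENNReal.ofReal c * ∫⁻ x in Ω, ENNReal.ofReal ‖u x‖ < ∞ := by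
        rw [← lintegral_const_mul' _ _ ENNReal.ofReal_ne_top]
        refine lt_of_le_of_lt (lintegral_mono_ae ?_) hB'
        filter_upwards [hlow] with x hx
        rw [← ENNReal.ofReal_mul hc.le]
        exact ENNReal.ofReal_le_ofReal (hx _)
      by_contra h
      rw [not_lt_top_iff.1 h, ENNReal.mul_top (by simpa using hc)] at h1
      exact lt_irrefl _ h1
    · rwa [gagliardoSeminorm_eq_setLIntegral_prod s Ω hum]
  refine ⟨huW, ?_⟩
  obtain ⟨hgi, hge⟩ := integrable_tailEnergy_and_renormalisedEnergy_eq hΩm hH hφ huW huφ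
  have hgagu := (integrableOn_prod_iff_gagliardoSeminorm_lt_top s Ω hum).2 huW.2.2
  have hgH : IntegrableOn (fun x => tailEnergy s Ω φ x (u x) + H x) Ω volume := hgi.add hHi
  rw [← ofReal_integral_eq_lintegral_ofReal hgagu
      (Filter.Eventually.of_forall fun z => by positivity),
    ← ofReal_integral_eq_lintegral_ofReal hgH (hBnn u)] at hAB
  have p1 : 0 ≤ ∫ z in Ω ×ˢ Ω, |u z.1 - u z.2| / ‖z.1 - z.2‖ ^ q :=
    integral_nonneg fun z => by positivity
  have p2 : 0 ≤ ∫ x in Ω, (tailEnergy s Ω φ x (u x) + H x) := integral_nonneg_of_ae (hBnn u)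
  have e2 : ∫ x in Ω, (tailEnergy s Ω φ x (u x) + H x) =
      (∫ x in Ω, tailEnergy s Ω φ x (u x)) + ∫ x in Ω, H x := integral_add hgi hHi
  rw [← ENNReal.ofReal_add p2 p2, ← ENNReal.ofReal_add p1 (add_nonneg p2 p2),
    ENNReal.ofReal_le_ofReal_iff hM0] at hAB
  rw [hge]
  linarith

/-- The limit is determined only almost everywhere in Ω; gluing it to φ outside makes the datum hold
at every exterior point. -/
lemma exists_renormalisedEnergy_le_of_tendsto {n : ℕ} {s : ℝ} (hs : 0 < s)
    {Ω : Set (EuclideanSpace ℝ (Fin n))} (hΩ : IsOpen Ω)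
    (hH : ∀ w ∈ sobolevSpaceW s Ω,
      ∫⁻ x in Ω, ENNReal.ofReal |w x| * kernelPotential s Ωᶜ x < ∞)
    {φ : EuclideanSpace ℝ (Fin n) → ℝ} (hφ : AEMeasurable φ (volume.restrict Ωᶜ))
    {c : ℝ} (hc : 0 < c) {H : EuclideanSpace ℝ (Fin n) → ℝ} (hHi : IntegrableOn H Ω volume)
    (hlow : ∀ᵐ x ∂volume.restrict Ω, ∀ t, c * |t| ≤ tailEnergy s Ω φ x t + H x)
    {f : ℕ → EuclideanSpace ℝ (Fin n) → ℝ} {M : ℝ} (hf : ∀ k, f k ∈ sobolevSpaceW s Ω)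
    (hfφ : ∀ k, ∀ᵐ x ∂volume, x ∈ Ωᶜ → f k x = φ x)
    (hlim : ∀ᵐ x ∂volume.restrict Ω, ∃ y,
      Filter.Tendsto (fun k => f k x) Filter.atTop (nhds y))
    (hM : Filter.Tendsto (fun k => renormalisedEnergy s Ω φ (f k)) Filter.atTop (nhds M)) :
    ∃ u ∈ sobolevSpaceWWithDatum s Ω φ, renormalisedEnergy s Ω φ u ≤ M := by
  have hΩm := hΩ.measurableSet
  obtain ⟨l, hlm, hl⟩ := measurable_limit_of_tendsto_metrizable_ae
    (fun k => (hf k).1.restrict (s := Ω)) hlim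
  have h0 := indicator_compl_mem_sobolevSpaceWWithDatum s hΩm hφ
  set u : EuclideanSpace ℝ (Fin n) → ℝ := fun x => Ω.indicator l x + Ωᶜ.indicator φ x with hu
  have hum : AEMeasurable u volume := (hlm.indicator hΩm).aemeasurable.add h0.1.1
  have huφ : ∀ x ∈ Ωᶜ, u x = φ x := fun x hx => by
    simp only [hu]
    rw [indicator_of_notMem hx, indicator_of_mem hx, zero_add]
  have hul : ∀ x ∈ Ω, u x = l x := fun x hx => by
    simp only [hu]
    rw [indicator_of_mem hx, indicator_of_notMem (notMem_compl_iff.2 hx), add_zero]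
  have hconv : ∀ᵐ x ∂volume.restrict Ω,
      Filter.Tendsto (fun k => f k x) Filter.atTop (nhds (u x)) := by
    filter_upwards [hl, ae_restrict_mem hΩm] with x hx hxΩ
    rwa [hul x hxΩ]
  obtain ⟨huW, hle⟩ := mem_sobolevSpaceW_and_renormalisedEnergy_le_of_tendsto hs hΩ hH hφ hc hHi
    hlow hf hfφ hum (Filter.Eventually.of_forall huφ) hconv hM
  exact ⟨u, ⟨huW, huφ⟩, hle⟩

/-! ### Existence of minimisers. -/

/-- Existence of `s`-minimal functions with given exterior datum, for domains that satisfy the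
fractional Hardy inequality. -/
theorem exists_isSMinimalFunction_of_hardy {n : ℕ} (hn : 1 ≤ n) {s : ℝ} (hs : 0 < s)
    {Ω : Set (EuclideanSpace ℝ (Fin n))} (hΩ : IsOpen Ω) (hb : Bornology.IsBounded Ω)
    (hd : 0 < Metric.diam Ω)
    (hH : ∀ w ∈ sobolevSpaceW s Ω,
      ∫⁻ x in Ω, ENNReal.ofReal |w x| * kernelPotential s Ωᶜ x < ∞)
    {φ : EuclideanSpace ℝ (Fin n) → ℝ} (hφ : AEMeasurable φ (volume.restrict Ωᶜ))
    (htail : localTailIntegral s Ω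
      (Metric.thickening (2 * 4 ^ (1 / s) * Metric.diam Ω) Ω) φ < ∞) :
    ∃ u ∈ sobolevSpaceWWithDatum s Ω φ, IsSMinimalFunction s Ω u := by
  have hΩm := hΩ.measurableSet
  set O := Metric.thickening (2 * 4 ^ (1 / s) * Metric.diam Ω) Ω with hO
  set c : ℝ := (kernelTail n s (2 * Metric.diam Ω)).toReal / 2 with hc
  have hc0 : 0 < c := by
    have h1 : 0 < kernelTail n s (2 * Metric.diam Ω) := by
      rw [kernelTail_eq n s (by positivity)]
      exact ENNReal.mul_pos (by rw [Ne, ENNReal.ofReal_eq_zero, not_le]; positivity)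
        (kernelTail_one_pos hn s).ne'
    have := ENNReal.toReal_pos h1.ne' (kernelTail_lt_top n hs (by positivity)).ne
    positivity
  have hhm : AEMeasurable (localTail s Ω O φ) (volume.restrict Ω) := by
    have hφ1 : AEMeasurable φ (volume.restrict (O \ Ω)) :=
      hφ.mono_measure (Measure.restrict_mono (fun y hy => hy.2) le_rfl)
    have hm : Measurable fun z : EuclideanSpace ℝ (Fin n) × EuclideanSpace ℝ (Fin n) =>
      ‖z.1 - z.2‖ ^ ((n : ℝ) + s) := by fun_prop
    exact AEMeasurable.lintegral_prod_right' (μ := volume.restrict Ω)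
      (f := fun z : _ × _ => ENNReal.ofReal (|φ z.2| / ‖z.1 - z.2‖ ^ ((n : ℝ) + s)))
      ((hφ1.comp_snd.norm.div hm.aemeasurable).ennreal_ofReal)
  have hHi : IntegrableOn (fun x => 2 * (localTail s Ω O φ x).toReal) Ω volume :=
    (integrable_toReal_of_lintegral_ne_top hhm htail.ne).const_mul 2
  have hlow : ∀ᵐ x ∂volume.restrict Ω, ∀ t, c * |t| ≤
      tailEnergy s Ω φ x t + 2 * (localTail s Ω O φ x).toReal := by
    filter_upwards [ae_lt_top' hhm htail.ne, ae_restrict_mem hΩm] with x hx hxΩ t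
    exact mul_abs_le_tailEnergy hs hΩ hb hd hφ hxΩ hx t
  have : IsFiniteMeasure (volume.restrict Ω) := ⟨by
    rw [Measure.restrict_apply_univ]; exact hb.measure_lt_top⟩
  have h0 := indicator_compl_mem_sobolevSpaceWWithDatum s hΩm hφ
  obtain ⟨u, hu, hmin⟩ := exists_forall_le_of_midpointConvex_of_coercive
    (μ := volume.restrict Ω)
    -- Competitors match the datum only almost everywhere, whereas the minimiser must match it
    -- everywhere; hence two classes.
    (𝒞 := {u | u ∈ sobolevSpaceW s Ω ∧ ∀ᵐ x ∂volume, x ∈ Ωᶜ → u x = φ x})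
    (𝒟 := sobolevSpaceWWithDatum s Ω φ) (T := renormalisedEnergy s Ω φ)
    (by positivity : 0 < 2 * c) ⟨_, h0.1, Filter.Eventually.of_forall h0.2⟩
    (fun u hu => hu.1.2.1)
    (fun u hu v hv => renormalisedEnergy_midpoint_le hΩm hH hφ hu.1 hu.2 hv.1 hv.2)
    (fun u hu => renormalisedEnergy_coercive hΩm hH hφ hHi hlow hu.1 hu.2)
    (fun f M hf hlim hM => exists_renormalisedEnergy_le_of_tendsto hs hΩ hH hφ hc0 hHi hlow
      (fun k => (hf k).1) (fun k => (hf k).2) hlim hM)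
  refine ⟨u, hu, hu.1, fun v hv huv => ?_⟩
  refine ⟨integrableOn_energyDifference_interactionSet hΩm hH hu.1 hv huv, ?_⟩
  have hvφ : ∀ᵐ x ∂volume, x ∈ Ωᶜ → v x = φ x := by
    filter_upwards [huv] with x hx hxΩ
    rw [← hx hxΩ, hu.2 x hxΩ]
  have hle := hmin v ⟨hv, hvφ⟩
  have iu : IntegrableOn (energyDifference s u (Ωᶜ.indicator φ)) (interactionSet Ω) volume :=
    integrableOn_energyDifference_interactionSet hΩm hH hu.1 h0.1
      (Filter.Eventually.of_forall fun x hx => (hu.2 x hx).trans (h0.2 x hx).symm)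
  have iv : IntegrableOn (energyDifference s v (Ωᶜ.indicator φ)) (interactionSet Ω) volume := by
    refine integrableOn_energyDifference_interactionSet hΩm hH hv h0.1 ?_
    filter_upwards [hvφ] with x hx hxΩ
    rw [hx hxΩ, h0.2 x hxΩ]
  -- The reference energy cancels, so minimality no longer depends on the renormalisation.
  have e : ∫ z in interactionSet Ω, energyDifference s u v z =
      renormalisedEnergy s Ω φ u - renormalisedEnergy s Ω φ v := by
    rw [renormalisedEnergy, renormalisedEnergy, ← integral_sub iu iv]
    refine integral_congr_ae (Filter.Eventually.of_forall fun z => ?_)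
    simp only [energyDifference]
    rw [← sub_div, sub_sub_sub_cancel_right]
  rw [e]
  linarith

end

theorem mainTheorem3 (n : ℕ) (hn : 1 ≤ n) (s : ℝ) (hs0 : 0 < s) (hs1 : s < 1) :
    ∃ Θ : ℝ, 1 < Θ ∧
      ∀ Ω : Set (EuclideanSpace ℝ (Fin n)),
        IsOpen Ω → Bornology.IsBounded Ω → HasLipschitzBoundary Ω →
        ∀ φ : EuclideanSpace ℝ (Fin n) → ℝ,
          AEMeasurable φ (volume.restrict Ωᶜ) →
          localTailIntegral s Ω (Metric.thickening (Θ * Metric.diam Ω) Ω) φ < ∞ →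
          ∃ u ∈ sobolevSpaceWWithDatum s Ω φ, IsSMinimalFunction s Ω u := by
  refine ⟨2 * 4 ^ (1 / s), ?_, ?_⟩
  · have : (1 : ℝ) ≤ 4 ^ (1 / s) := Real.one_le_rpow (by norm_num) (by positivity)
    linarith
  intro Ω hΩ hb hL φ hφ htail
  -- The coercivity estimate needs a positive diameter, which fails for the empty set; there Q(Ω) is
  -- empty and every admissible function is minimal.
  rcases Ω.eq_empty_or_nonempty with rfl | ⟨x, hx⟩
  · have h0 := indicator_compl_mem_sobolevSpaceWWithDatum s MeasurableSet.empty hφ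
    refine ⟨_, h0, h0.1, fun v _ _ => ?_⟩
    simp [interactionSet]
  · have : Nonempty (Fin n) := ⟨⟨0, hn⟩⟩
    have hd : 0 < Metric.diam Ω :=
      Metric.diam_pos (infinite_of_mem_nhds x (hΩ.mem_nhds hx)).nontrivial hb
    exact exists_isSMinimalFunction_of_hardy hn hs0 hΩ hb hd
      (fun w hw => lintegral_abs_mul_kernelPotential_compl_lt_top hs0 hs1 hΩ hb hL hw) hφ htail
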